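/- Let $L$ be a linear subspace of $\mathbb{R}^d$ and let $\mathcal{A}$ be a finite collection of linear hyperplanes of $L$, i.e. of linear subspaces of $L$ of codimension one in $L$. Let $\mathcal{N}(\mathcal{A})$ be the fan of $\mathcal{A}$: the set of closures of the connected components of $L\setminus\bigcup\mathcal{A}$. For a polyhedral cone $C\subseteq\mathbb{R}^d$ and $k\ge 0$ let $\Pi_k(C)$ be the set of all $x\in\mathbb{R}^d$ whose nearest point in $C$ lies in the relative interior of a $k$-dimensional face of $C$. The $k$-th spherical intrinsic volume of $C$ is $v_k(C)=\operatorname{vol}(\Pi_k(C)\cap B_d)/\operatorname{vol}(B_d)$, where $B_d$ is the unit ball of $\mathbb{R}^d$. Put $v_k(\mathcal{N}(\mathcal{A}))=\sum_{C\in\mathcal{N}(\mathcal{A})}v_k(C)$ and $$\overline{\chi}_{\mathcal{N}(\mathcal{A})}(t)=\sum_{k=0}^{d}v_k(\mathcal{N}(\mathcal{A}))\,t^k .$$ The unsigned characteristic polynomial $\overline{\chi}_{\mathcal{A}}(t)$ of an arrangement $\mathcal{A}$ in $L$ is defined recursively: $\overline{\chi}_{\emptyset}(t)=t^{\dim L}$;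 $\overline{\chi}_{\mathcal{A}}(t)=t^{\dim L}+t^{\dim L-1}$ if $\mathcal{A}$ consists of one hyperplane; and $\overline{\chi}_{\mathcal{A}}(t)=\overline{\chi}_{\mathcal{A}\setminus H}(t)+\overline{\chi}_{\mathcal{A}|_H}(t)$ for any $H\in\mathcal{A}$ if $\mathcal{A}$ has at least two hyperplanes, where $\mathcal{A}\setminus H=\{H'\in\mathcal{A}:H'\ne H\}$ is an arrangement in $L$ and $\mathcal{A}|_H=\{H'\cap H:H'\in\mathcal{A},\,H'\neq H\}$ is an arrangement in $H$. Then $\mathcal{N}(\mathcal{A})$ is finite, the recursion gives the same polynomial for all choices of the hyperplanes $H$, and $$\overline{\chi}_{\mathcal{N}(\mathcal{A})}(t)=\overline{\chi}_{\mathcal{A}}(t)=(-1)^{\dim L}\chi_{\mathcal{A}}(-t),$$ where $\chi_{\mathcal{A}}(t)=\sum_F\mu(L,F)\,t^{\dim F}$ is the usual characteristic polynomial; here $F$ runs over the flats of $\mathcal{A}$ (all intersections of members of $\mathcal{A}$, the empty intersection being $L$) and $\mu$ is the Möbius function of the set of flats ordered by reverse inclusion. Equivalently, for every $k\ge 0$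 the number $v_k(\mathcal{N}(\mathcal{A}))$ is the unsigned Whitney number of the first kind $$w_k(\mathcal{A})=\Bigl|\sum_{\dim F=k}\mu(L,F)\Bigr| .$$ -/

import Mathlib

open Polynomial MeasureTheory
open scoped Classical

noncomputable section

namespace HypArr

/-! ### Spherical intrinsic volumes of cones and fans -/

/-- `y` is a point of `C` nearest to `x` (it is unique if `C` is nonempty, closed and convex). -/
def IsNearestPoint {d : ℕ} (C : Set (EuclideanSpace ℝ (Fin d)))
    (x y : EuclideanSpace ℝ (Fin d)) : Prop :=
  y ∈ C ∧ ∀ z ∈ C, ‖x - y‖ ≤ ‖x - z‖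

/-- The set `Π_k(C)` of all points `x` whose nearest point in `C` lies in the relative interior of
a `k`-dimensional face of `C`. A face is the set of maximizers over `C` of a linear functional
(`C` itself comes from the zero functional); the dimension of a face of a cone is the dimension
of its linear hull. -/
def projSet {d : ℕ} (k : ℕ) (C : Set (EuclideanSpace ℝ (Fin d))) :
    Set (EuclideanSpace ℝ (Fin d)) :=
  {x | ∃ y F, IsNearestPoint C x y ∧ IsExposed ℝ C F ∧ y ∈ intrinsicInterior ℝ F ∧
    Module.finrank ℝ (Submodule.span ℝ F) = k}

/-- The `k`-th spherical intrinsic volume `v_k(C) = vol(Π_k(C) ∩ B_d) / vol(B_d)`. -/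
def sphVol {d : ℕ} (k : ℕ) (C : Set (EuclideanSpace ℝ (Fin d))) : ℝ :=
  volume.real (projSet k C ∩ Metric.closedBall 0 1) /
    volume.real (Metric.closedBall (0 : EuclideanSpace ℝ (Fin d)) 1)

/-- `v_k` of a fan: the sum of `v_k(C)` over the finitely many cones `C` of the fan. -/
def fanSphVol {d : ℕ} (k : ℕ) (N : Set (Set (EuclideanSpace ℝ (Fin d)))) : ℝ :=
  ∑ᶠ C ∈ N, sphVol k C

/-- The characteristic polynomial `v_0(N) + v_1(N) t + ⋯ + v_d(N) t^d` of a fan `N` in `ℝ^d`. -/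
def fanCharPoly {d : ℕ} (N : Set (Set (EuclideanSpace ℝ (Fin d)))) : ℝ[X] :=
  ∑ k ∈ Finset.range (d + 1), C (fanSphVol k N) * X ^ k

/-! ### Hyperplane arrangements -/

/-- `A` is an arrangement of linear hyperplanes in the subspace `L` of `ℝ^d`. -/
def IsArrangement {d : ℕ} (L : Submodule ℝ (EuclideanSpace ℝ (Fin d)))
    (A : Finset (Submodule ℝ (EuclideanSpace ℝ (Fin d)))) : Prop :=
  ∀ H ∈ A, H ≤ L ∧ Module.finrank ℝ H + 1 = Module.finrank ℝ L

/-- The complement `L \ ⋃ A`. -/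
def complement {d : ℕ} (L : Submodule ℝ (EuclideanSpace ℝ (Fin d)))
    (A : Finset (Submodule ℝ (EuclideanSpace ℝ (Fin d)))) : Set (EuclideanSpace ℝ (Fin d)) :=
  {x | x ∈ L ∧ ∀ H ∈ A, x ∉ H}

/-- The fan of an arrangement: the closures of the connected components of the complement. -/
def arrFan {d : ℕ} (L : Submodule ℝ (EuclideanSpace ℝ (Fin d)))
    (A : Finset (Submodule ℝ (EuclideanSpace ℝ (Fin d)))) :
    Set (Set (EuclideanSpace ℝ (Fin d))) :=
  (fun x => closure (connectedComponentIn (complement L A) x)) '' complement L A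

/-- The restriction `A|H = {H' ∩ H : H' ∈ A, H' ≠ H}`, an arrangement in `H`. -/
def restriction {d : ℕ} (A : Finset (Submodule ℝ (EuclideanSpace ℝ (Fin d))))
    (H : Submodule ℝ (EuclideanSpace ℝ (Fin d))) :
    Finset (Submodule ℝ (EuclideanSpace ℝ (Fin d))) :=
  (A.erase H).image (fun H' => H' ⊓ H)

/-- `IsUnsignedCharPoly L A p`: the polynomial `p` is a value of the deletion-restriction
recursion for the unsigned characteristic polynomial of the arrangement `A` in `L`, for some
choice of the hyperplane `H` at each step. The empty arrangement, which the recursion started at a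
nonempty arrangement never reaches, has the polynomial `t ^ dim L`. -/
inductive IsUnsignedCharPoly {d : ℕ} : Submodule ℝ (EuclideanSpace ℝ (Fin d)) →
    Finset (Submodule ℝ (EuclideanSpace ℝ (Fin d))) → ℝ[X] → Prop
  | empty (L : Submodule ℝ (EuclideanSpace ℝ (Fin d))) :
      IsUnsignedCharPoly L ∅ (X ^ Module.finrank ℝ L)
  | singleton (L H : Submodule ℝ (EuclideanSpace ℝ (Fin d))) :
      IsUnsignedCharPoly L {H} (X ^ Module.finrank ℝ L + X ^ (Module.finrank ℝ L - 1))
  | deletion_restriction (L : Submodule ℝ (EuclideanSpace ℝ (Fin d)))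
      (A : Finset (Submodule ℝ (EuclideanSpace ℝ (Fin d))))
      (H : Submodule ℝ (EuclideanSpace ℝ (Fin d))) (p q : ℝ[X])
      (hH : H ∈ A) (hA : 1 < A.card)
      (hp : IsUnsignedCharPoly L (A.erase H) p)
      (hq : IsUnsignedCharPoly H (restriction A H) q) :
      IsUnsignedCharPoly L A (p + q)

/-! ### The characteristic polynomial through the lattice of flats -/

/-- The flats of `A`: all intersections of members of `A`, the empty intersection being `L`. -/
def flats {d : ℕ} (L : Submodule ℝ (EuclideanSpace ℝ (Fin d)))
    (A : Finset (Submodule ℝ (EuclideanSpace ℝ (Fin d)))) :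
    Finset (Submodule ℝ (EuclideanSpace ℝ (Fin d))) :=
  A.powerset.image (fun B => L ⊓ B.inf id)

theorem self_mem_flats {d : ℕ} (L : Submodule ℝ (EuclideanSpace ℝ (Fin d)))
    (A : Finset (Submodule ℝ (EuclideanSpace ℝ (Fin d)))) : L ∈ flats L A :=
  Finset.mem_image.2 ⟨∅, by simp, by simp⟩

/-- The lattice of flats, ordered by reverse inclusion. -/
abbrev FlatLattice {d : ℕ} (L : Submodule ℝ (EuclideanSpace ℝ (Fin d)))
    (A : Finset (Submodule ℝ (EuclideanSpace ℝ (Fin d)))) : Type :=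
  ({F // F ∈ flats L A})ᵒᵈ

instance {d : ℕ} (L : Submodule ℝ (EuclideanSpace ℝ (Fin d)))
    (A : Finset (Submodule ℝ (EuclideanSpace ℝ (Fin d)))) :
    LocallyFiniteOrder (FlatLattice L A) :=
  Fintype.toLocallyFiniteOrder

/-- The Möbius function value `μ(L, F)` in the lattice of flats (its minimum is `L`). -/
def flatMu {d : ℕ} (L : Submodule ℝ (EuclideanSpace ℝ (Fin d)))
    (A : Finset (Submodule ℝ (EuclideanSpace ℝ (Fin d)))) (F : {F // F ∈ flats L A}) : ℤ :=
  IncidenceAlgebra.mu ℤ (α := FlatLattice L A)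
    (OrderDual.toDual ⟨L, self_mem_flats L A⟩) (OrderDual.toDual F)

/-- The usual characteristic polynomial `χ_A(t) = ∑_F μ(L, F) t ^ dim F`, over all flats `F`. -/
def charPoly {d : ℕ} (L : Submodule ℝ (EuclideanSpace ℝ (Fin d)))
    (A : Finset (Submodule ℝ (EuclideanSpace ℝ (Fin d)))) : ℤ[X] :=
  ∑ F : {F // F ∈ flats L A}, C (flatMu L A F) * X ^ Module.finrank ℝ F.1

/-- The unsigned Whitney number of the first kind, indexed by dimension:
`w_k(A) = |∑_F μ(L, F)|`, over all flats `F` of dimension `k`. -/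
def whitneyNumber {d : ℕ} (L : Submodule ℝ (EuclideanSpace ℝ (Fin d)))
    (A : Finset (Submodule ℝ (EuclideanSpace ℝ (Fin d)))) (k : ℕ) : ℤ :=
  |∑ F : {F // F ∈ flats L A} with Module.finrank ℝ F.1 = k, flatMu L A F|

end HypArr

end

/-! Both sides satisfy the same deletion-restriction recursion, up to sign.

Geometric side (`fanSphVol_deletion_restriction`): adding `H` to `A.erase H` cuts some chambers `D`
into two halves `D₊`, `D₋` with section `D₀ = D ∩ H`; the sections are exactly the chambers of the
restriction. It suffices that `v_k(D₊) + v_k(D₋) = v_k(D) + v_k(D₀)`. Let `y` be the point of `D`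
nearest to `z`. If `y` is strictly on one side of `H`, it is also nearest in that half, while the
nearest point of the other half lies in `H` and so is nearest in `D₀`. If `y ∈ H`, all four sets
share the nearest point `y`, and the face dimensions agree once the smallest flat `F` of `A.erase H`
through `y` lies in `H`. Otherwise, `z - y ⊥ F` puts `z` in the proper subspace `(F ∩ H) + Fᗮ`, a
null set. This is `mem_projSet_cut`; it rests on `projSet_chamber`, which replaces faces by the
dimension of the smallest flat through the nearest point.

Algebraic side (`charPoly_deletion_restriction`): by Whitney's theorem the characteristic polynomial
is a signed sum over subfamilies of `A`, which splits according to whether `H` belongs to the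
subfamily.

Every value of the recursion therefore equals the fan polynomial, which involves no choices, and
induction on the number of hyperplanes gives the remaining identities. Nonnegativity of volumes
turns signed coefficients into absolute values. -/

namespace HypArr

/-! ### Möbius function, Whitney's theorem, deletion-restriction for the characteristic polynomial
-/

section Combinatorics

variable {d : ℕ} {L H : Submodule ℝ (EuclideanSpace ℝ (Fin d))}
  {A A' : Finset (Submodule ℝ (EuclideanSpace ℝ (Fin d)))}

theorem le_of_mem_flats {F : Submodule ℝ (EuclideanSpace ℝ (Fin d))} (hF : F ∈ flats L A) :
    F ≤ L := by
  obtain ⟨B, -, rfl⟩ := Finset.mem_image.1 hF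
  exact inf_le_left

/-- A function on subspaces whose sums over upper sets of flats vanish, except for the one with
the single element `L`, agrees with the Möbius function. -/
theorem flatMu_eq_of_sum (m : Submodule ℝ (EuclideanSpace ℝ (Fin d)) → ℤ)
    (hm : ∀ G ∈ flats L A, ∑ F ∈ (flats L A).filter (G ≤ ·), m F = if G = L then 1 else 0)
    (G : {F // F ∈ flats L A}) : flatMu L A G = m G.1 := by
  have key : ∀ b : FlatLattice L A,
      IncidenceAlgebra.mu ℤ (α := FlatLattice L A)
        (OrderDual.toDual ⟨L, self_mem_flats L A⟩) b = m (OrderDual.ofDual b).1 := by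
    intro b
    induction b using WellFoundedLT.induction with
    | ind b ih =>
      set a : FlatLattice L A := OrderDual.toDual ⟨L, self_mem_flats L A⟩ with ha
      have hab : a ≤ b := le_of_mem_flats (OrderDual.ofDual b).2
      have h1 := IncidenceAlgebra.sum_Icc_mu_right (𝕜 := ℤ) a b
      have h2 := hm (OrderDual.ofDual b).1 (OrderDual.ofDual b).2
      have h3 : ∑ F ∈ (flats L A).filter ((OrderDual.ofDual b).1 ≤ ·), m F =
          ∑ x ∈ Finset.Icc a b, m (OrderDual.ofDual x).1 := by
        symm
        refine Finset.sum_bij (fun x _ => (OrderDual.ofDual x).1) ?_ ?_ ?_ ?_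
        · intro x hx
          exact Finset.mem_filter.2 ⟨(OrderDual.ofDual x).2, (Finset.mem_Icc.1 hx).2⟩
        · intro x _ y _ hxy
          exact OrderDual.ofDual.injective (Subtype.ext hxy)
        · intro F hF
          obtain ⟨hF, hle⟩ := Finset.mem_filter.1 hF
          exact ⟨OrderDual.toDual ⟨F, hF⟩,
            Finset.mem_Icc.2 ⟨le_of_mem_flats hF, hle⟩, rfl⟩
        · intros
          rfl
      have h4 : (a = b) ↔ ((OrderDual.ofDual b).1 = L) := by
        constructor
        · rintro rfl
          rfl
        · intro h
          exact OrderDual.ofDual.injective (Subtype.ext h.symm)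
      rw [h3] at h2
      simp only [← h4] at h2
      -- Both defining sums are split at their last term; the remaining terms agree by induction.
      rw [Finset.Icc_eq_cons_Ico hab, Finset.sum_cons] at h1 h2
      have h5 : ∑ x ∈ Finset.Ico a b, IncidenceAlgebra.mu ℤ (α := FlatLattice L A) a x =
          ∑ x ∈ Finset.Ico a b, m (OrderDual.ofDual x).1 :=
        Finset.sum_congr rfl fun x hx => ih x (Finset.mem_Ico.1 hx).2
      linarith
  exact key _

theorem charPoly_eq_of_sum (m : Submodule ℝ (EuclideanSpace ℝ (Fin d)) → ℤ)
    (hm : ∀ G ∈ flats L A, ∑ F ∈ (flats L A).filter (G ≤ ·), m F = if G = L then 1 else 0) :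
    charPoly L A = ∑ F ∈ flats L A, C (m F) * X ^ Module.finrank ℝ F := by
  rw [charPoly, ← Finset.sum_coe_sort (flats L A)]
  exact Finset.sum_congr rfl fun F _ => by rw [flatMu_eq_of_sum m hm F]

/-- **Whitney's theorem** for the characteristic polynomial of an arrangement. -/
theorem charPoly_eq_sum_powerset (hflats : flats L A' = flats L A) (hL : ∀ H ∈ A, ¬ L ≤ H) :
    charPoly L A' =
      ∑ B ∈ A.powerset, C ((-1 : ℤ) ^ B.card) * X ^ Module.finrank ℝ ↥(L ⊓ B.inf id) := by
  have hmem : ∀ B ∈ A.powerset, L ⊓ B.inf id ∈ flats L A :=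
    fun B hB => Finset.mem_image_of_mem _ hB
  -- The candidate for the Möbius function groups the subfamilies by their intersection.
  rw [charPoly_eq_of_sum
    (fun F => ∑ B ∈ A.powerset with L ⊓ B.inf id = F, (-1 : ℤ) ^ B.card), hflats]
  · rw [← Finset.sum_fiberwise_of_maps_to hmem]
    refine Finset.sum_congr rfl fun F _ => ?_
    rw [map_sum, Finset.sum_mul]
    refine Finset.sum_congr rfl fun B hB => ?_
    rw [(Finset.mem_filter.1 hB).2]
  · rw [hflats]
    intro G hG
    -- The intersection of a subfamily contains `G` iff all its members do, so the double sum is an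
    -- alternating sum over a power set. It vanishes unless no member of `A` contains `G`, which for
    -- a flat means `G = L`.
    have h1 : ∑ F ∈ (flats L A).filter (G ≤ ·),
        ∑ B ∈ A.powerset with L ⊓ B.inf id = F, (-1 : ℤ) ^ B.card =
        ∑ B ∈ (A.filter (G ≤ ·)).powerset, (-1 : ℤ) ^ B.card := by
      have hset : (A.filter (G ≤ ·)).powerset =
          A.powerset.filter (fun B => G ≤ L ⊓ B.inf id) := by
        ext B
        simp only [Finset.mem_powerset, Finset.mem_filter, le_inf_iff, le_of_mem_flats hG,
          true_and, Finset.le_inf_iff, id, Finset.subset_iff]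
        grind
      have hmaps : ∀ B ∈ (A.filter (G ≤ ·)).powerset,
          L ⊓ B.inf id ∈ (flats L A).filter (G ≤ ·) := by
        intro B hB
        rw [hset, Finset.mem_filter] at hB
        exact Finset.mem_filter.2 ⟨hmem B hB.1, hB.2⟩
      rw [← Finset.sum_fiberwise_of_maps_to hmaps]
      refine Finset.sum_congr rfl fun F hF => Finset.sum_congr ?_ fun _ _ => rfl
      rw [hset]
      ext B
      simp only [Finset.mem_filter] at hF ⊢
      constructor
      · rintro ⟨h, rfl⟩
        exact ⟨⟨h, hF.2⟩, rfl⟩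
      · rintro ⟨⟨h, -⟩, rfl⟩
        exact ⟨h, rfl⟩
    rw [h1, Finset.sum_powerset_neg_one_pow_card]
    refine if_congr ?_ rfl rfl
    rw [Finset.filter_eq_empty_iff]
    constructor
    · intro h
      obtain ⟨B, hB, rfl⟩ := Finset.mem_image.1 hG
      rcases B.eq_empty_or_nonempty with rfl | ⟨H, hH⟩
      · simp
      · exact absurd (inf_le_right.trans (Finset.inf_le (f := id) hH))
          (h (Finset.mem_powerset.1 hB hH))
    · rintro rfl H hH
      exact hL H hH

/-- Distinct hyperplanes may have the same trace on `H`, but flats do not see multiplicities. Hence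
Whitney's sum for the restriction can run over subfamilies of `A.erase H` itself, which is why
`charPoly_eq_sum_powerset` allows two families. -/
theorem flats_restriction : flats H (restriction A H) = flats H (A.erase H) := by
  have key : ∀ B : Finset (Submodule ℝ (EuclideanSpace ℝ (Fin d))),
      H ⊓ (B.image (fun H' => H' ⊓ H)).inf id = H ⊓ B.inf id := by
    intro B
    rw [Finset.inf_image]
    apply le_antisymm
    · refine le_inf inf_le_left (Finset.le_inf fun K hK => ?_)
      exact inf_le_right.trans ((Finset.inf_le hK).trans inf_le_left)
    · refine le_inf inf_le_left (Finset.le_inf fun K hK => ?_)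
      exact le_inf (inf_le_right.trans (Finset.inf_le (f := id) hK)) inf_le_left
  ext F
  simp only [flats, restriction, Finset.mem_image, Finset.mem_powerset]
  constructor
  · rintro ⟨B, hB, rfl⟩
    obtain ⟨B', hB', rfl⟩ := Finset.subset_image_iff.1 hB
    exact ⟨B', hB', (key B').symm⟩
  · rintro ⟨B, hB, rfl⟩
    exact ⟨_, Finset.image_subset_image hB, key B⟩

theorem IsArrangement.not_le (hA : IsArrangement L A) (hH : H ∈ A) : ¬ L ≤ H := by
  intro h
  have h1 := Submodule.finrank_mono h
  have h2 := (hA H hH).2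
  omega

theorem IsArrangement.eq_of_le (hA : IsArrangement L A)
    {H' : Submodule ℝ (EuclideanSpace ℝ (Fin d))} (hH : H ∈ A) (hH' : H' ∈ A) (h : H ≤ H') :
    H = H' :=
  Submodule.eq_of_le_of_finrank_eq h (by have := (hA H hH).2; have := (hA H' hH').2; omega)

theorem IsArrangement.erase (hA : IsArrangement L A) : IsArrangement L (A.erase H) :=
  fun H' hH' => hA H' (Finset.mem_of_mem_erase hH')

/-- Two distinct hyperplanes of `L` together span `L`; the dimension formula then gives the
codimension of their intersection. -/
theorem IsArrangement.restriction (hA : IsArrangement L A) (hH : H ∈ A) :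
    IsArrangement H (restriction A H) := by
  intro K hK
  obtain ⟨H', hH', rfl⟩ := Finset.mem_image.1 hK
  obtain ⟨hne, hH'⟩ := Finset.mem_erase.1 hH'
  refine ⟨inf_le_right, ?_⟩
  have h1 := Submodule.finrank_sup_add_finrank_inf_eq H' H
  have h2 : H' < H' ⊔ H :=
    lt_of_le_of_ne le_sup_left fun h => hne (hA.eq_of_le hH hH' (h ▸ le_sup_right)).symm
  have h3 := Submodule.finrank_lt_finrank_of_lt h2
  have h4 := Submodule.finrank_mono (sup_le (hA H' hH').1 (hA H hH).1)
  have h5 := (hA H' hH').2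
  have h6 := (hA H hH).2
  omega

theorem charPoly_empty : charPoly L ∅ = X ^ Module.finrank ℝ L := by
  rw [charPoly_eq_sum_powerset rfl (by simp), Finset.powerset_empty, Finset.sum_singleton,
    Finset.inf_empty, inf_top_eq]
  simp

theorem charPoly_deletion_restriction (hA : IsArrangement L A) (hH : H ∈ A) :
    charPoly L A = charPoly L (A.erase H) - charPoly H (restriction A H) := by
  have hH' : H ∉ A.erase H := Finset.notMem_erase H A
  rw [charPoly_eq_sum_powerset rfl (fun _ => hA.not_le),
    charPoly_eq_sum_powerset (L := L) (A := A.erase H) rfl (fun _ => hA.erase.not_le),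
    charPoly_eq_sum_powerset (L := H) (A := A.erase H) flats_restriction]
  · conv_lhs => rw [← Finset.insert_erase hH]
    rw [Finset.sum_powerset_insert hH', sub_eq_add_neg, ← Finset.sum_neg_distrib]
    congr 1
    refine Finset.sum_congr rfl fun B hB => ?_
    have hB' : H ∉ B := fun h => hH' (Finset.mem_powerset.1 hB h)
    have h1 : L ⊓ (insert H B).inf id = H ⊓ B.inf id := by
      rw [Finset.inf_insert, id, ← inf_assoc, inf_eq_right.2 (hA H hH).1]
    rw [h1, Finset.card_insert_of_notMem hB', pow_succ]
    simp
  · intro H' h' hle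
    obtain ⟨hne, h'⟩ := Finset.mem_erase.1 h'
    exact hne (hA.eq_of_le hH h' hle).symm

theorem coeff_charPoly (k : ℕ) : (charPoly L A).coeff k =
    ∑ F : {F // F ∈ flats L A} with Module.finrank ℝ F.1 = k, flatMu L A F := by
  rw [charPoly, finsetSum_coeff, Finset.sum_filter]
  refine Finset.sum_congr rfl fun F _ => ?_
  rw [coeff_C_mul, coeff_X_pow]
  simp [eq_comm]

end Combinatorics

/-! ### Nearest points in convex sets -/

section NearestPoint

variable {d : ℕ} {D : Set (EuclideanSpace ℝ (Fin d))} {x x' y y' z w : EuclideanSpace ℝ (Fin d)}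

theorem isNearestPoint_iff (hD : Convex ℝ D) :
    IsNearestPoint D x y ↔ y ∈ D ∧ ∀ z ∈ D, inner ℝ (x - y) (z - y) ≤ 0 := by
  refine and_congr_right fun hy => ?_
  rw [← norm_eq_iInf_iff_real_inner_le_zero hD hy]
  have hbdd : BddBelow (Set.range fun w : D => ‖x - w‖) :=
    ⟨0, by rintro _ ⟨w, rfl⟩; positivity⟩
  have : Nonempty D := ⟨⟨y, hy⟩⟩
  constructor
  · intro h
    exact le_antisymm (le_ciInf fun w => h w w.2) (ciInf_le hbdd ⟨y, hy⟩)
  · intro h z hz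
    rw [h]
    exact ciInf_le hbdd ⟨z, hz⟩

theorem exists_isNearestPoint (hD : Convex ℝ D) (hc : IsClosed D) (hne : D.Nonempty)
    (x : EuclideanSpace ℝ (Fin d)) : ∃ y, IsNearestPoint D x y := by
  obtain ⟨y, hy, h⟩ := exists_norm_eq_iInf_of_complete_convex hne hc.isComplete hD x
  exact ⟨y, (isNearestPoint_iff hD).2 ⟨hy, (norm_eq_iInf_iff_real_inner_le_zero hD hy).1 h⟩⟩

/-- Add the two variational inequalities and apply Cauchy-Schwarz. Uniqueness of the nearest point
and continuity of the projection both follow. -/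
theorem IsNearestPoint.norm_sub_le (hD : Convex ℝ D) (h : IsNearestPoint D x y)
    (h' : IsNearestPoint D x' y') : ‖y - y'‖ ≤ ‖x - x'‖ := by
  rw [isNearestPoint_iff hD] at h h'
  have h1 := h.2 y' h'.1
  have h2 := h'.2 y h.1
  have h3 : inner ℝ (y - y') (y - y') ≤ inner ℝ (x - x') (y - y') := by
    have e : inner ℝ (x - x') (y - y') - inner ℝ (y - y') (y - y') =
        -(inner ℝ (x - y) (y' - y) + inner ℝ (x' - y') (y - y')) := by
      simp only [inner_sub_left, inner_sub_right]
      ring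
    linarith
  rw [real_inner_self_eq_norm_mul_norm] at h3
  have h4 := h3.trans (real_inner_le_norm _ _)
  rcases (norm_nonneg (y - y')).eq_or_lt with h0 | h0
  · rw [← h0]
    positivity
  · exact le_of_mul_le_mul_right h4 h0

theorem IsNearestPoint.unique (hD : Convex ℝ D) (h : IsNearestPoint D x y)
    (h' : IsNearestPoint D x y') : y = y' := by
  have := h.norm_sub_le hD h'
  rwa [sub_self, norm_zero, norm_le_zero_iff, sub_eq_zero] at this

theorem IsNearestPoint.mono {D' : Set (EuclideanSpace ℝ (Fin d))} (h : IsNearestPoint D x y)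
    (hsub : D' ⊆ D) (hy : y ∈ D') : IsNearestPoint D' x y :=
  ⟨hy, fun z hz => h.2 z (hsub hz)⟩

/-- If the nearest point in `D` lies strictly on one side of a hyperplane, then the nearest point
in the part of `D` on the other side lies in the hyperplane. -/
theorem IsNearestPoint.inner_eq_zero (hD : Convex ℝ D) {v : EuclideanSpace ℝ (Fin d)}
    (hy : IsNearestPoint D x y) (hv : 0 < inner ℝ v y)
    (hw : IsNearestPoint (D ∩ {z | inner ℝ v z ≤ 0}) x w) : inner ℝ v w = 0 := by
  have hconv : Convex ℝ (D ∩ {z | inner ℝ v z ≤ 0}) :=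
    hD.inter (convex_halfSpace_le ⟨inner_add_right v, fun c z => by simp [inner_smul_right]⟩ 0)
  by_contra hne
  have hlt : inner ℝ v w < 0 := lt_of_le_of_ne hw.1.2 hne
  obtain ⟨hwD, -⟩ := hw.1
  have h1 := ((isNearestPoint_iff hD).1 hy).2 w hwD
  -- The parameter at which the segment from `w` to `y` crosses the hyperplane. Minimality of `w`
  -- against the crossing point, combined with minimality of `y` against `w`, forces `y = w`.
  set t : ℝ := inner ℝ v w / (inner ℝ v w - inner ℝ v y) with ht
  have hden : inner ℝ v w - inner ℝ v y < 0 := by linarith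
  have ht0 : 0 < t := div_pos_of_neg_of_neg hlt hden
  have ht1 : t ≤ 1 := (div_le_one_of_neg hden).2 (by linarith)
  have hu : w + t • (y - w) ∈ D ∩ {z | inner ℝ v z ≤ 0} := by
    refine ⟨hD.add_smul_sub_mem hwD hy.1 ⟨ht0.le, ht1⟩, ?_⟩
    refine le_of_eq (?_ : inner ℝ v _ = 0)
    rw [inner_add_right, inner_smul_right, inner_sub_right, ht]
    have := hden.ne
    field_simp
    ring
  have h2 := ((isNearestPoint_iff hconv).1 hw).2 _ hu
  rw [add_sub_cancel_left, inner_smul_right] at h2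
  have h3 : inner ℝ (x - w) (y - w) ≤ 0 := by
    by_contra h
    exact absurd h2 (not_le.2 (mul_pos ht0 (not_le.1 h)))
  have h4 : inner ℝ (y - w) (y - w) ≤ 0 := by
    have e : inner ℝ (y - w) (y - w) =
        inner ℝ (x - w) (y - w) + inner ℝ (x - y) (w - y) := by
      simp only [inner_sub_left, inner_sub_right]
      ring
    linarith
  have h5 : y = w := by
    rw [real_inner_self_nonpos, sub_eq_zero] at h4
    exact h4
  rw [h5] at hv
  linarith

/-- The set of points whose nearest point in a closed convex set lies in a measurable set is
measurable. -/
theorem measurableSet_exists_isNearestPoint (hD : Convex ℝ D) (hc : IsClosed D)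
    (hne : D.Nonempty) {S : Set (EuclideanSpace ℝ (Fin d))} (hS : MeasurableSet S) :
    MeasurableSet {x | ∃ y, IsNearestPoint D x y ∧ y ∈ S} := by
  choose p hp using exists_isNearestPoint hD hc hne
  have hcont : Continuous p := by
    refine LipschitzWith.continuous (K := 1) (LipschitzWith.of_dist_le_mul fun a b => ?_)
    simpa [dist_eq_norm] using (hp a).norm_sub_le hD (hp b)
  convert hcont.measurable hS using 1
  ext x
  constructor
  · rintro ⟨y, hy, hyS⟩
    rwa [hy.unique hD (hp x)] at hyS
  · intro h
    exact ⟨p x, hp x, h⟩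

end NearestPoint

/-! ### Chambers as sign cells of normal functionals -/

section Chamber

variable {d : ℕ} {L : Submodule ℝ (EuclideanSpace ℝ (Fin d))}
  {A : Finset (Submodule ℝ (EuclideanSpace ℝ (Fin d)))}
  {n : Submodule ℝ (EuclideanSpace ℝ (Fin d)) → EuclideanSpace ℝ (Fin d)}
  {x y w : EuclideanSpace ℝ (Fin d)}

/-- The vectors `n H` are normal vectors of the members `H` of `A`, as hyperplanes in `L`. -/
def IsNormal (n : Submodule ℝ (EuclideanSpace ℝ (Fin d)) → EuclideanSpace ℝ (Fin d))
    (L : Submodule ℝ (EuclideanSpace ℝ (Fin d)))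
    (A : Finset (Submodule ℝ (EuclideanSpace ℝ (Fin d)))) : Prop :=
  ∀ H ∈ A, ∀ x ∈ L, x ∈ H ↔ inner ℝ (n H) x = 0

theorem IsNormal.mono {L' : Submodule ℝ (EuclideanSpace ℝ (Fin d))}
    {A' : Finset (Submodule ℝ (EuclideanSpace ℝ (Fin d)))} (hn : IsNormal n L A) (hL : L' ≤ L)
    (hA : A' ⊆ A) : IsNormal n L' A' :=
  fun H hH x hx => hn H (hA hH) x (hL hx)

/-- Take `v` spanning the line `Hᗮ ⊓ L`. The component of `x` orthogonal to `H` is a multiple of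
`v`, and it is orthogonal to itself when `x ⊥ v`. -/
theorem exists_mem_iff_inner_eq_zero {H : Submodule ℝ (EuclideanSpace ℝ (Fin d))} (hHL : H ≤ L)
    (hdim : Module.finrank ℝ H + 1 = Module.finrank ℝ L) :
    ∃ v : EuclideanSpace ℝ (Fin d), ∀ x ∈ L, x ∈ H ↔ inner ℝ v x = 0 := by
  have h1 := Submodule.finrank_add_inf_finrank_orthogonal hHL
  have h2 : Module.finrank ℝ ↥(Hᗮ ⊓ L) = 1 := by omega
  obtain ⟨⟨v, hvm⟩, hv0, hv⟩ := finrank_eq_one_iff'.1 h2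
  refine ⟨v, fun x hx => ⟨fun hxH => ?_, fun h => ?_⟩⟩
  · exact Submodule.inner_left_of_mem_orthogonal hxH hvm.1
  · have hp : x - H.starProjection x ∈ Hᗮ ⊓ L :=
      ⟨H.sub_starProjection_mem_orthogonal x,
        L.sub_mem hx (hHL (H.starProjection_apply_mem x))⟩
    obtain ⟨c, hc⟩ := hv ⟨_, hp⟩
    have hc' : c • v = x - H.starProjection x := congrArg Subtype.val hc
    have h3 : inner ℝ (c • v) (c • v) = 0 := by
      conv_lhs => rw [hc', inner_sub_left]
      rw [← hc', inner_smul_right, inner_smul_right, real_inner_comm v x, h,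
        Submodule.inner_right_of_mem_orthogonal (H.starProjection_apply_mem x) hvm.1]
      simp
    rw [inner_self_eq_zero, hc', sub_eq_zero] at h3
    rw [h3]
    exact H.starProjection_apply_mem x

theorem IsArrangement.exists_isNormal (hA : IsArrangement L A) : ∃ n, IsNormal n L A := by
  have : ∀ H, ∃ v : EuclideanSpace ℝ (Fin d), H ∈ A → ∀ x ∈ L, x ∈ H ↔ inner ℝ v x = 0 := by
    intro H
    by_cases hH : H ∈ A
    · obtain ⟨v, hv⟩ := exists_mem_iff_inner_eq_zero (hA H hH).1 (hA H hH).2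
      exact ⟨v, fun _ => hv⟩
    · exact ⟨0, fun h => absurd h hH⟩
  choose n hn using this
  exact ⟨n, hn⟩

/-- The closed chamber of `x`: the points of `L` weakly on the same side as `x` of all members of
`A`. -/
def chamber (n : Submodule ℝ (EuclideanSpace ℝ (Fin d)) → EuclideanSpace ℝ (Fin d))
    (L : Submodule ℝ (EuclideanSpace ℝ (Fin d)))
    (A : Finset (Submodule ℝ (EuclideanSpace ℝ (Fin d)))) (x : EuclideanSpace ℝ (Fin d)) :
    Set (EuclideanSpace ℝ (Fin d)) :=
  {y | y ∈ L ∧ ∀ H ∈ A, 0 ≤ inner ℝ (n H) x * inner ℝ (n H) y}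

theorem self_mem_chamber (hx : x ∈ L) : x ∈ chamber n L A x :=
  ⟨hx, fun _ _ => mul_self_nonneg _⟩

theorem convex_chamber : Convex ℝ (chamber n L A x) := by
  intro y hy z hz a b ha hb _
  refine ⟨L.add_mem (L.smul_mem a hy.1) (L.smul_mem b hz.1), fun H hH => ?_⟩
  have h1 := mul_nonneg ha (hy.2 H hH)
  have h2 := mul_nonneg hb (hz.2 H hH)
  rw [inner_add_right, inner_smul_right, inner_smul_right]
  linarith

theorem isClosed_chamber : IsClosed (chamber n L A x) := by
  have : chamber n L A x =
      (L : Set _) ∩ ⋂ H ∈ A, {y | 0 ≤ inner ℝ (n H) x * inner ℝ (n H) y} := by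
    ext y
    simp [chamber]
  rw [this]
  exact L.closed_of_finiteDimensional.inter
    (isClosed_biInter fun H _ => isClosed_le (by fun_prop) (by fun_prop))

theorem IsNormal.inner_ne_zero (hn : IsNormal n L A) (hx : x ∈ complement L A)
    {H : Submodule ℝ (EuclideanSpace ℝ (Fin d))} (hH : H ∈ A) : inner ℝ (n H) x ≠ 0 :=
  fun h => hx.2 H hH ((hn H hH x hx.1).2 h)

/-- The component is the open sign cell of `x`: this cell is convex, and no normal functional can
change sign on a connected set where it has no zero. Each point of the closed cell is the end of a
segment from `x` whose interior lies in the open cell. -/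
theorem IsNormal.closure_connectedComponentIn (hn : IsNormal n L A) (hx : x ∈ complement L A) :
    closure (connectedComponentIn (complement L A) x) = chamber n L A x := by
  set U : Set (EuclideanSpace ℝ (Fin d)) :=
    {y | y ∈ L ∧ ∀ H ∈ A, 0 < inner ℝ (n H) x * inner ℝ (n H) y} with hU
  have hxU : x ∈ U := ⟨hx.1, fun H hH => mul_self_pos.2 (hn.inner_ne_zero hx hH)⟩
  have hconv : Convex ℝ U := by
    rw [convex_iff_forall_pos]
    intro y hy z hz a b ha hb _
    refine ⟨L.add_mem (L.smul_mem a hy.1) (L.smul_mem b hz.1), fun H hH => ?_⟩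
    have h1 := mul_pos ha (hy.2 H hH)
    have h2 := mul_pos hb (hz.2 H hH)
    rw [inner_add_right, inner_smul_right, inner_smul_right]
    linarith
  have hUc : U ⊆ complement L A := fun y hy =>
    ⟨hy.1, fun H hH hyH => by
      have := hy.2 H hH
      rw [(hn H hH y hy.1).1 hyH, mul_zero] at this
      exact lt_irrefl _ this⟩
  have hcomp : connectedComponentIn (complement L A) x = U := by
    apply Set.Subset.antisymm
    · intro y hy
      have hyc := connectedComponentIn_subset _ _ hy
      refine ⟨hyc.1, fun H hH => ?_⟩
      by_contra hneg
      have hcont : ContinuousOn (fun z => inner ℝ (n H) x * inner ℝ (n H) z)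
          (connectedComponentIn (complement L A) x) := by fun_prop
      obtain ⟨z, hz, hz0⟩ := isPreconnected_connectedComponentIn.intermediate_value hy
        (mem_connectedComponentIn hx) hcont
        ⟨not_lt.1 hneg, (mul_self_pos.2 (hn.inner_ne_zero hx hH)).le⟩
      exact mul_ne_zero (hn.inner_ne_zero hx hH)
        (hn.inner_ne_zero (connectedComponentIn_subset _ _ hz) hH) hz0
    · exact hconv.isPreconnected.subset_connectedComponentIn hxU hUc
  rw [hcomp]
  apply Set.Subset.antisymm
  · exact closure_minimal (fun y hy => ⟨hy.1, fun H hH => (hy.2 H hH).le⟩) isClosed_chamber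
  · intro y hy
    have hseg : openSegment ℝ x y ⊆ U := by
      rintro _ ⟨a, b, ha, hb, -, rfl⟩
      refine ⟨L.add_mem (L.smul_mem a hx.1) (L.smul_mem b hy.1), fun H hH => ?_⟩
      have h1 := mul_pos ha (hxU.2 H hH)
      have h2 := mul_nonneg hb.le (hy.2 H hH)
      rw [inner_add_right, inner_smul_right, inner_smul_right]
      linarith
    apply closure_mono hseg
    rw [closure_openSegment]
    exact right_mem_segment ℝ x y

theorem IsNormal.arrFan_eq (hn : IsNormal n L A) :
    arrFan L A = chamber n L A '' complement L A :=
  Set.image_congr fun _ hx => hn.closure_connectedComponentIn hx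

theorem IsNormal.chamber_eq_of_mem (hn : IsNormal n L A) (hx : x ∈ complement L A)
    (hy : y ∈ complement L A) (h : y ∈ chamber n L A x) : chamber n L A x = chamber n L A y := by
  ext z
  refine and_congr_right fun _ => forall₂_congr fun H hH => ?_
  have hpos : 0 < inner ℝ (n H) x * inner ℝ (n H) y :=
    lt_of_le_of_ne (h.2 H hH)
      (mul_ne_zero (hn.inner_ne_zero hx hH) (hn.inner_ne_zero hy hH)).symm
  rcases mul_pos_iff.1 hpos with ⟨h1, h2⟩ | ⟨h1, h2⟩
  · rw [mul_nonneg_iff_of_pos_left h1, mul_nonneg_iff_of_pos_left h2]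
  · constructor <;> intro h3 <;> nlinarith

/-- A chamber is determined by the set of hyperplanes on whose positive side it lies. -/
theorem IsNormal.finite_arrFan (hn : IsNormal n L A) : (arrFan L A).Finite := by
  rw [hn.arrFan_eq]
  refine (Set.finite_range fun B : A.powerset => {y | y ∈ L ∧ ∀ H ∈ A,
    0 ≤ (if H ∈ B.1 then (1 : ℝ) else -1) * inner ℝ (n H) y}).subset ?_
  rintro _ ⟨x, hx, rfl⟩
  refine ⟨⟨A.filter fun H => 0 < inner ℝ (n H) x,
    Finset.mem_powerset.2 (Finset.filter_subset _ _)⟩, ?_⟩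
  ext y
  refine and_congr_right fun _ => forall₂_congr fun H hH => ?_
  rcases lt_or_gt_of_ne (hn.inner_ne_zero hx hH) with h | h
  · simp only [Finset.mem_filter, not_lt.2 h.le, and_false, if_false]
    constructor <;> intro h3 <;> nlinarith
  · simp only [Finset.mem_filter, h, hH, and_self, if_true, one_mul]
    rw [mul_nonneg_iff_of_pos_left h]

theorem complement_restriction {H : Submodule ℝ (EuclideanSpace ℝ (Fin d))} :
    complement H (restriction A H) = complement H (A.erase H) := by
  ext x
  refine and_congr_right fun hx => ?_
  simp only [restriction, Finset.forall_mem_image, Submodule.mem_inf, hx, and_true]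

theorem arrFan_restriction {H : Submodule ℝ (EuclideanSpace ℝ (Fin d))} :
    arrFan H (restriction A H) = arrFan H (A.erase H) := by
  rw [arrFan, complement_restriction, arrFan]

end Chamber

/-! ### Faces of chambers and the smallest flat through a point -/

section Faces

variable {d : ℕ} {L : Submodule ℝ (EuclideanSpace ℝ (Fin d))}
  {A : Finset (Submodule ℝ (EuclideanSpace ℝ (Fin d)))}
  {n : Submodule ℝ (EuclideanSpace ℝ (Fin d)) → EuclideanSpace ℝ (Fin d)}
  {x y z w : EuclideanSpace ℝ (Fin d)}

theorem mem_intrinsicInterior_iff_eventually {F : Set (EuclideanSpace ℝ (Fin d))} :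
    y ∈ intrinsicInterior ℝ F ↔
      y ∈ F ∧ ∀ᶠ z in nhds y, z ∈ affineSpan ℝ F → z ∈ F := by
  have key : ∀ h : y ∈ affineSpan ℝ F, (⟨y, h⟩ : affineSpan ℝ F) ∈
      interior ((↑) ⁻¹' F : Set (affineSpan ℝ F)) ↔
        ∀ᶠ z in nhds y, z ∈ affineSpan ℝ F → z ∈ F := by
    intro h
    rw [mem_interior_iff_mem_nhds]
    exact (preimage_coe_mem_nhds_subtype (s := (affineSpan ℝ F : Set (EuclideanSpace ℝ (Fin d))))).trans
      mem_nhdsWithin_iff_eventually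
  rw [mem_intrinsicInterior]
  constructor
  · rintro ⟨⟨y, h⟩, hy, rfl⟩
    have hyF : (⟨y, h⟩ : affineSpan ℝ F) ∈ ((↑) ⁻¹' F : Set (affineSpan ℝ F)) :=
      interior_subset hy
    exact ⟨hyF, (key h).1 hy⟩
  · rintro ⟨hy, h⟩
    exact ⟨⟨y, subset_affineSpan ℝ F hy⟩, (key _).2 h, rfl⟩

/-- The smallest flat of `A` containing a point `y` of `L`. -/
noncomputable def flatOf (L : Submodule ℝ (EuclideanSpace ℝ (Fin d)))
    (A : Finset (Submodule ℝ (EuclideanSpace ℝ (Fin d)))) (y : EuclideanSpace ℝ (Fin d)) :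
    Submodule ℝ (EuclideanSpace ℝ (Fin d)) :=
  L ⊓ (A.filter (y ∈ ·)).inf id

theorem mem_flatOf : w ∈ flatOf L A y ↔ w ∈ L ∧ ∀ H ∈ A, y ∈ H → w ∈ H := by
  simp [flatOf, Submodule.mem_finsetInf]

theorem flatOf_mem_flats : flatOf L A y ∈ flats L A :=
  Finset.mem_image_of_mem _ (Finset.mem_powerset.2 (Finset.filter_subset _ _))

theorem self_mem_flatOf (hy : y ∈ L) : y ∈ flatOf L A y :=
  mem_flatOf.2 ⟨hy, fun _ _ h => h⟩

/-- Near one of its points, a chamber contains the smallest flat containing this point. -/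
theorem IsNormal.eventually_mem_chamber (hn : IsNormal n L A) (hx : x ∈ complement L A)
    (hy : y ∈ chamber n L A x) :
    ∀ᶠ z in nhds y, z ∈ flatOf L A y → z ∈ chamber n L A x := by
  have h : ∀ᶠ z in nhds y, ∀ H ∈ A, y ∉ H → 0 < inner ℝ (n H) x * inner ℝ (n H) z := by
    rw [Filter.eventually_all_finset]
    intro H hH
    by_cases hyH : y ∈ H
    · simp [hyH]
    · have hpos : 0 < inner ℝ (n H) x * inner ℝ (n H) y :=
        lt_of_le_of_ne (hy.2 H hH)
          (mul_ne_zero (hn.inner_ne_zero hx hH) (fun h => hyH ((hn H hH y hy.1).2 h))).symm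
      have hcont : Continuous fun z => inner ℝ (n H) x * inner ℝ (n H) z := by fun_prop
      filter_upwards [hcont.continuousAt.eventually_const_lt hpos] with z hz _ using hz
  filter_upwards [h] with z hz hzF
  rw [mem_flatOf] at hzF
  refine ⟨hzF.1, fun H hH => ?_⟩
  by_cases hyH : y ∈ H
  · rw [(hn H hH z hzF.1).1 (hzF.2 H hH hyH), mul_zero]
  · exact (hz H hH hyH).le

/-- One step size serves both directions, so that inequalities at `y + s • w` and `y - s • w`
combine to equalities. -/
theorem eventually_add_smul {p : EuclideanSpace ℝ (Fin d) → Prop} (h : ∀ᶠ z in nhds y, p z)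
    (w : EuclideanSpace ℝ (Fin d)) : ∃ s : ℝ, 0 < s ∧ p (y + s • w) ∧ p (y - s • w) := by
  have h1 : Filter.Tendsto (fun s : ℝ => y + s • w) (nhds 0) (nhds y) :=
    Continuous.tendsto' (by fun_prop) _ _ (by simp)
  have h2 : Filter.Tendsto (fun s : ℝ => y - s • w) (nhds 0) (nhds y) :=
    Continuous.tendsto' (by fun_prop) _ _ (by simp)
  obtain ⟨s, ⟨ha, hb⟩, hs⟩ := ((((h1.eventually h).and (h2.eventually h)).filter_mono
    nhdsWithin_le_nhds).and (self_mem_nhdsWithin (a := (0 : ℝ)) (s := Set.Ioi 0))).exists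
  exact ⟨s, hs, ha, hb⟩

theorem IsNormal.exists_add_sub_mem_chamber (hn : IsNormal n L A) (hx : x ∈ complement L A)
    (hy : y ∈ chamber n L A x) (hw : w ∈ flatOf L A y) :
    ∃ s : ℝ, 0 < s ∧ y + s • w ∈ chamber n L A x ∧ y - s • w ∈ chamber n L A x := by
  obtain ⟨s, hs, h1, h2⟩ := eventually_add_smul (hn.eventually_mem_chamber hx hy) w
  have hyF : y ∈ flatOf L A y := self_mem_flatOf hy.1
  exact ⟨s, hs, h1 (add_mem hyF (Submodule.smul_mem _ s hw)),
    h2 (sub_mem hyF (Submodule.smul_mem _ s hw))⟩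

/-- A face of a chamber spans the smallest flat containing a given relatively interior point. -/
theorem IsNormal.span_eq_flatOf (hn : IsNormal n L A) (hx : x ∈ complement L A)
    {F : Set (EuclideanSpace ℝ (Fin d))} (hF : IsExposed ℝ (chamber n L A x) F)
    (hy : y ∈ intrinsicInterior ℝ F) : Submodule.span ℝ F = flatOf L A y := by
  rw [mem_intrinsicInterior_iff_eventually] at hy
  obtain ⟨hyF, hev⟩ := hy
  obtain ⟨l, rfl⟩ := hF ⟨y, hyF⟩
  set F := {u ∈ chamber n L A x | ∀ v ∈ chamber n L A x, l v ≤ l u} with hFdef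
  apply le_antisymm
  · rw [Submodule.span_le]
    intro z hz
    refine mem_flatOf.2 ⟨hz.1.1, fun H hH hyH => ?_⟩
    -- A relatively interior point can be moved slightly away from `z` within the face. A functional
    -- that is nonnegative on the chamber and zero at `y` must then vanish at `z`.
    obtain ⟨s, hs, -, h⟩ := eventually_add_smul hev (z - y)
    have hzA : z ∈ affineSpan ℝ F := subset_affineSpan ℝ F hz
    have hyA : y ∈ affineSpan ℝ F := subset_affineSpan ℝ F hyF
    have hmem : y - s • (z - y) ∈ affineSpan ℝ F := by
      have := AffineSubspace.vadd_mem_of_mem_direction ((affineSpan ℝ F).direction.smul_mem (-s)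
        (AffineSubspace.vsub_mem_direction hzA hyA)) hyA
      simpa [vadd_eq_add, vsub_eq_sub, neg_smul, sub_eq_add_neg, add_comm] using this
    have h1 := (h hmem).1.2 H hH
    have h2 := hz.1.2 H hH
    have hy0 := (hn H hH y hyF.1.1).1 hyH
    rw [inner_sub_right, inner_smul_right, inner_sub_right, hy0] at h1
    have h3 : inner ℝ (n H) x * inner ℝ (n H) z = 0 := by
      apply le_antisymm _ h2
      by_contra hcon
      have := mul_pos hs (not_le.1 hcon)
      linarith
    exact (hn H hH z hz.1.1).2
      ((mul_eq_zero.1 h3).resolve_left (hn.inner_ne_zero hx hH))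
  · intro w hw
    obtain ⟨s, hs, h1, h2⟩ := hn.exists_add_sub_mem_chamber hx hyF.1 hw
    have h3 := hyF.2 _ h1
    have h4 := hyF.2 _ h2
    have h5 : l (y + s • w) = l y := by
      simp only [map_add, map_sub, map_smul, smul_eq_mul] at h3 h4 ⊢
      linarith
    have h6 : y + s • w ∈ F := ⟨h1, fun v hv => by rw [h5]; exact hyF.2 v hv⟩
    have h7 : w = s⁻¹ • ((y + s • w) - y) := by
      rw [add_sub_cancel_left, smul_smul, inv_mul_cancel₀ hs.ne', one_smul]
    rw [h7]
    exact Submodule.smul_mem _ _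
      (sub_mem (Submodule.subset_span h6) (Submodule.subset_span hyF))

theorem IsNormal.exists_isExposed (hn : IsNormal n L A) (hx : x ∈ complement L A)
    (hy : y ∈ chamber n L A x) :
    ∃ F, IsExposed ℝ (chamber n L A x) F ∧ y ∈ intrinsicInterior ℝ F := by
  -- Minus the sum of the sign-normalised functionals of the hyperplanes through `y`: it is
  -- nonpositive on the chamber and vanishes there exactly on the smallest flat through `y`.
  set l : EuclideanSpace ℝ (Fin d) →L[ℝ] ℝ :=
    -∑ H ∈ A.filter (y ∈ ·), inner ℝ (n H) x • innerSL ℝ (n H) with hl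
  have hlv : ∀ v, l v = -∑ H ∈ A.filter (y ∈ ·), inner ℝ (n H) x * inner ℝ (n H) v := by
    intro v
    simp [hl]
  have hnonneg : ∀ v ∈ chamber n L A x, ∀ H ∈ A.filter (y ∈ ·),
      0 ≤ inner ℝ (n H) x * inner ℝ (n H) v :=
    fun v hv H hH => hv.2 H (Finset.mem_filter.1 hH).1
  have hle : ∀ v ∈ chamber n L A x, l v ≤ 0 := by
    intro v hv
    rw [hlv, neg_nonpos]
    exact Finset.sum_nonneg (hnonneg v hv)
  have hzero : ∀ v ∈ chamber n L A x, l v = 0 ↔ v ∈ flatOf L A y := by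
    intro v hv
    rw [hlv, neg_eq_zero, Finset.sum_eq_zero_iff_of_nonneg (hnonneg v hv), mem_flatOf]
    simp only [Finset.mem_filter, hv.1, true_and, and_imp]
    refine forall₃_congr fun H hH _ => ?_
    rw [hn H hH v hv.1, mul_eq_zero, or_iff_right (hn.inner_ne_zero hx hH)]
  have hly : l y = 0 := (hzero y hy).2 (self_mem_flatOf hy.1)
  have hface : {u ∈ chamber n L A x | ∀ v ∈ chamber n L A x, l v ≤ l u} =
      chamber n L A x ∩ flatOf L A y := by
    ext u
    refine and_congr_right fun hu => ?_
    rw [SetLike.mem_coe, ← hzero u hu]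
    constructor
    · intro h
      exact le_antisymm (hle u hu) (hly ▸ h y hy)
    · intro h v hv
      rw [h]
      exact hle v hv
  refine ⟨_, fun _ => ⟨l, rfl⟩, ?_⟩
  rw [hface, mem_intrinsicInterior_iff_eventually]
  refine ⟨⟨hy, self_mem_flatOf hy.1⟩, ?_⟩
  filter_upwards [hn.eventually_mem_chamber hx hy] with z hz hzA
  have hsub : affineSpan ℝ (chamber n L A x ∩ flatOf L A y) ≤
      (flatOf L A y).toAffineSubspace :=
    affineSpan_le.2 Set.inter_subset_right
  have hzF : z ∈ flatOf L A y := hsub hzA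
  exact ⟨hz hzF, hzF⟩

theorem IsNormal.projSet_chamber (hn : IsNormal n L A) (hx : x ∈ complement L A) (k : ℕ) :
    projSet k (chamber n L A x) =
      {z | ∃ y, IsNearestPoint (chamber n L A x) z y ∧
        y ∈ {y | Module.finrank ℝ (flatOf L A y) = k}} := by
  ext z
  constructor
  · rintro ⟨y, F, hnear, hF, hy, rfl⟩
    exact ⟨y, hnear, by rw [hn.span_eq_flatOf hx hF hy]; rfl⟩
  · rintro ⟨y, hnear, hk⟩
    obtain ⟨F, hF, hy⟩ := hn.exists_isExposed hx hnear.1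
    exact ⟨y, F, hnear, hF, hy, by rw [hn.span_eq_flatOf hx hF hy]; exact hk⟩

theorem IsNormal.mem_projSet_iff (hn : IsNormal n L A) (hx : x ∈ complement L A) {k : ℕ}
    (h : IsNearestPoint (chamber n L A x) z y) :
    z ∈ projSet k (chamber n L A x) ↔ Module.finrank ℝ (flatOf L A y) = k := by
  rw [hn.projSet_chamber hx]
  constructor
  · rintro ⟨y', h', hk⟩
    rw [h.unique convex_chamber h']
    exact hk
  · intro hk
    exact ⟨y, h, hk⟩

/-- The flat depends only on which members of `A` contain `y`, so the set is a finite union of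
Boolean combinations of subspaces. -/
theorem measurableSet_finrank_flatOf (k : ℕ) :
    MeasurableSet {y | Module.finrank ℝ (flatOf L A y) = k} := by
  have : {y | Module.finrank ℝ (flatOf L A y) = k} =
      ⋃ B ∈ A.powerset.filter (fun B => Module.finrank ℝ ↥(L ⊓ B.inf id) = k),
        ⋂ H ∈ A, {y : EuclideanSpace ℝ (Fin d) | y ∈ H ↔ H ∈ B} := by
    ext y
    simp only [Set.mem_iUnion, Set.mem_iInter, Set.mem_ofPred_eq, exists_prop, Finset.mem_filter,
      Finset.mem_powerset]
    constructor
    · intro h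
      exact ⟨A.filter (y ∈ ·), ⟨Finset.filter_subset _ _, h⟩, fun H hH => by simp [hH]⟩
    · rintro ⟨B, ⟨hBA, hk⟩, hB⟩
      have : A.filter (y ∈ ·) = B := by
        ext H
        rw [Finset.mem_filter]
        exact ⟨fun h => (hB H h.1).1 h.2, fun h => ⟨hBA h, (hB H (hBA h)).2 h⟩⟩
      rw [flatOf, this]
      exact hk
  rw [this]
  refine Finset.measurableSet_biUnion _ fun B _ => Finset.measurableSet_biInter _ fun H _ => ?_
  have hH : MeasurableSet (H : Set (EuclideanSpace ℝ (Fin d))) :=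
    H.closed_of_finiteDimensional.measurableSet
  by_cases hHB : H ∈ B
  · simpa [hHB] using hH
  · convert hH.compl using 1
    ext
    simp [hHB]

theorem IsNormal.measurableSet_projSet (hn : IsNormal n L A) (hx : x ∈ complement L A) (k : ℕ) :
    MeasurableSet (projSet k (chamber n L A x)) := by
  rw [hn.projSet_chamber hx]
  exact measurableSet_exists_isNearestPoint convex_chamber isClosed_chamber
    ⟨x, self_mem_chamber hx.1⟩ (measurableSet_finrank_flatOf k)

/-- Small moves from `y` along the flat in both directions stay in the chamber, so the variational
inequality holds with both signs. -/
theorem IsNormal.sub_mem_orthogonal_flatOf (hn : IsNormal n L A) (hx : x ∈ complement L A)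
    (h : IsNearestPoint (chamber n L A x) z y) : z - y ∈ (flatOf L A y)ᗮ := by
  rw [Submodule.mem_orthogonal']
  intro w hw
  obtain ⟨s, hs, h1, h2⟩ := hn.exists_add_sub_mem_chamber hx h.1 hw
  have h' := ((isNearestPoint_iff convex_chamber).1 h).2
  have h3 := h' _ h1
  have h4 := h' _ h2
  rw [add_sub_cancel_left, inner_smul_right] at h3
  rw [sub_sub_cancel_left, inner_neg_right, inner_smul_right] at h4
  have h5 : s * inner ℝ (z - y) w = 0 := by linarith
  exact (mul_eq_zero.1 h5).resolve_left hs.ne'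

end Faces

/-! ### Cutting one chamber by a hyperplane -/

section Deletion

variable {d : ℕ} {L H : Submodule ℝ (EuclideanSpace ℝ (Fin d))}
  {A : Finset (Submodule ℝ (EuclideanSpace ℝ (Fin d)))}
  {n : Submodule ℝ (EuclideanSpace ℝ (Fin d)) → EuclideanSpace ℝ (Fin d)}
  {x y z w : EuclideanSpace ℝ (Fin d)}

theorem mem_complement_iff_erase (hH : H ∈ A) :
    x ∈ complement L A ↔ x ∈ complement L (A.erase H) ∧ x ∉ H := by
  constructor
  · rintro ⟨h1, h2⟩
    exact ⟨⟨h1, fun K hK => h2 K (Finset.mem_of_mem_erase hK)⟩, h2 H hH⟩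
  · rintro ⟨⟨h1, h2⟩, h3⟩
    refine ⟨h1, fun K hK => ?_⟩
    by_cases hKH : K = H
    · rwa [hKH]
    · exact h2 K (Finset.mem_erase.2 ⟨hKH, hK⟩)

theorem chamber_eq_erase_inter (hH : H ∈ A) :
    chamber n L A x =
      chamber n L (A.erase H) x ∩ {y | 0 ≤ inner ℝ (n H) x * inner ℝ (n H) y} := by
  ext y
  constructor
  · rintro ⟨h1, h2⟩
    exact ⟨⟨h1, fun K hK => h2 K (Finset.mem_of_mem_erase hK)⟩, h2 H hH⟩
  · rintro ⟨⟨h1, h2⟩, h3⟩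
    refine ⟨h1, fun K hK => ?_⟩
    by_cases hKH : K = H
    · rwa [hKH]
    · exact h2 K (Finset.mem_erase.2 ⟨hKH, hK⟩)

theorem chamber_of_pos (hH : H ∈ A) (hx : 0 < inner ℝ (n H) x) :
    chamber n L A x = chamber n L (A.erase H) x ∩ {y | 0 ≤ inner ℝ (n H) y} := by
  rw [chamber_eq_erase_inter hH]
  simp only [mul_nonneg_iff_of_pos_left hx]

theorem chamber_of_neg (hH : H ∈ A) (hx : inner ℝ (n H) x < 0) :
    chamber n L A x = chamber n L (A.erase H) x ∩ {y | inner ℝ (n H) y ≤ 0} := by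
  rw [chamber_eq_erase_inter hH]
  have h : ∀ y, 0 ≤ inner ℝ (n H) x * inner ℝ (n H) y ↔ inner ℝ (n H) y ≤ 0 := fun y =>
    ⟨fun h => by nlinarith, mul_nonneg_of_nonpos_of_nonpos hx.le⟩
  simp only [h]

theorem IsNormal.chamber_inter (hn : IsNormal n L A) (hH : H ∈ A) (hHL : H ≤ L) :
    chamber n H (A.erase H) x = chamber n L (A.erase H) x ∩ {y | inner ℝ (n H) y = 0} := by
  ext y
  constructor
  · rintro ⟨h1, h2⟩
    exact ⟨⟨hHL h1, h2⟩, (hn H hH y (hHL h1)).1 h1⟩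
  · rintro ⟨⟨h1, h2⟩, h3⟩
    exact ⟨(hn H hH y h1).2 h3, h2⟩

theorem flatOf_erase_of_notMem (hy : y ∉ H) : flatOf L (A.erase H) y = flatOf L A y := by
  ext w
  simp only [mem_flatOf, Finset.mem_erase, and_imp]
  refine and_congr_right fun _ => forall_congr' fun K => ?_
  constructor
  · intro h hK hyK
    exact h (by rintro rfl; exact hy hyK) hK hyK
  · intro h _ hK hyK
    exact h hK hyK

theorem flatOf_of_mem (hH : H ∈ A) (hHL : H ≤ L) (hy : y ∈ H) :
    flatOf L A y = flatOf H (A.erase H) y := by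
  ext w
  simp only [mem_flatOf, Finset.mem_erase, and_imp]
  constructor
  · rintro ⟨_, h⟩
    exact ⟨h H hH hy, fun K _ hK hyK => h K hK hyK⟩
  · rintro ⟨h1, h⟩
    refine ⟨hHL h1, fun K hK hyK => ?_⟩
    by_cases hKH : K = H
    · rwa [hKH]
    · exact h K hKH hK hyK

theorem flatOf_erase_of_le (hle : flatOf L (A.erase H) y ≤ H) :
    flatOf L (A.erase H) y = flatOf L A y := by
  apply le_antisymm
  · intro w hw
    refine mem_flatOf.2 ⟨(mem_flatOf.1 hw).1, fun K hK hyK => ?_⟩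
    by_cases hKH : K = H
    · rw [hKH]
      exact hle hw
    · exact (mem_flatOf.1 hw).2 K (Finset.mem_erase.2 ⟨hKH, hK⟩) hyK
  · intro w hw
    exact mem_flatOf.2 ⟨(mem_flatOf.1 hw).1, fun K hK hyK =>
      (mem_flatOf.1 hw).2 K (Finset.mem_of_mem_erase hK) hyK⟩

/-- If `f ∈ F` is written as `a + b` with `a ∈ F ⊓ H` and `b ∈ Fᗮ`, then `b = f - a` also lies in
`F`, so `b = 0` and `f ∈ H`. -/
theorem sup_orthogonal_ne_top {F : Submodule ℝ (EuclideanSpace ℝ (Fin d))} (hF : ¬ F ≤ H) :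
    (F ⊓ H) ⊔ Fᗮ ≠ ⊤ := by
  intro h
  apply hF
  intro f hf
  have hf' : f ∈ (F ⊓ H) ⊔ Fᗮ := h ▸ Submodule.mem_top
  obtain ⟨a, ha, b, hb, rfl⟩ := Submodule.mem_sup.1 hf'
  have hbF : b ∈ F := by simpa using F.sub_mem hf ha.1
  have hb0 : b = 0 := by
    have := Submodule.inner_right_of_mem_orthogonal hbF hb
    rwa [inner_self_eq_zero] at this
  rw [hb0, add_zero]
  exact ha.2

theorem ae_notMem_sup_orthogonal (S : Finset (Submodule ℝ (EuclideanSpace ℝ (Fin d))))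
    (H : Submodule ℝ (EuclideanSpace ℝ (Fin d))) :
    ∀ᵐ z ∂(volume : Measure (EuclideanSpace ℝ (Fin d))),
      ∀ F ∈ S, ¬ F ≤ H → z ∉ (F ⊓ H) ⊔ Fᗮ := by
  rw [Filter.eventually_all_finset]
  intro F _
  by_cases hF : F ≤ H
  · simp [hF]
  · have h0 := Measure.addHaar_submodule volume _ (sup_orthogonal_ne_top hF)
    filter_upwards [measure_eq_zero_iff_ae_notMem.1 h0] with z hz _ using hz

/-- Cutting a chamber by a further hyperplane `H`: outside of a null set, a point is counted by
the projection sets of the two halves as often as by those of the chamber and of its section. -/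
theorem IsNormal.mem_projSet_cut (hn : IsNormal n L A) (hH : H ∈ A) (hHL : H ≤ L)
    {D Dp Dm D0 : Set (EuclideanSpace ℝ (Fin d))} {x xp xm x0 : EuclideanSpace ℝ (Fin d)}
    (hx : x ∈ complement L (A.erase H)) (hD : chamber n L (A.erase H) x = D)
    (hxp : xp ∈ complement L A) (hDp : chamber n L A xp = Dp)
    (hxm : xm ∈ complement L A) (hDm : chamber n L A xm = Dm)
    (hx0 : x0 ∈ complement H (A.erase H)) (hD0 : chamber n H (A.erase H) x0 = D0)
    (hp : Dp = D ∩ {y | 0 ≤ inner ℝ (n H) y}) (hm : Dm = D ∩ {y | inner ℝ (n H) y ≤ 0})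
    (h0 : D0 = D ∩ {y | inner ℝ (n H) y = 0}) (k : ℕ)
    (hz : ∀ F ∈ flats L (A.erase H), ¬ F ≤ H → z ∉ (F ⊓ H) ⊔ Fᗮ) :
    ((z ∈ projSet k Dp ∨ z ∈ projSet k Dm) ↔ (z ∈ projSet k D ∨ z ∈ projSet k D0)) ∧
    ((z ∈ projSet k Dp ∧ z ∈ projSet k Dm) ↔ (z ∈ projSet k D ∧ z ∈ projSet k D0)) := by
  have hn' : IsNormal n L (A.erase H) := hn.mono le_rfl (Finset.erase_subset _ _)
  have hnH : IsNormal n H (A.erase H) := hn.mono hHL (Finset.erase_subset _ _)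
  have hconv : Convex ℝ D := hD ▸ convex_chamber
  have iffD : ∀ {y}, IsNearestPoint D z y →
      (z ∈ projSet k D ↔ Module.finrank ℝ (flatOf L (A.erase H) y) = k) := by
    subst hD
    exact hn'.mem_projSet_iff hx
  have iffp : ∀ {y}, IsNearestPoint Dp z y →
      (z ∈ projSet k Dp ↔ Module.finrank ℝ (flatOf L A y) = k) := by
    rw [← hDp]
    exact hn.mem_projSet_iff hxp
  have iffm : ∀ {y}, IsNearestPoint Dm z y →
      (z ∈ projSet k Dm ↔ Module.finrank ℝ (flatOf L A y) = k) := by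
    rw [← hDm]
    exact hn.mem_projSet_iff hxm
  have iff0 : ∀ {y}, IsNearestPoint D0 z y →
      (z ∈ projSet k D0 ↔ Module.finrank ℝ (flatOf H (A.erase H) y) = k) := by
    rw [← hD0]
    exact hnH.mem_projSet_iff hx0
  have hsubp : Dp ⊆ D := hp ▸ Set.inter_subset_left
  have hsubm : Dm ⊆ D := hm ▸ Set.inter_subset_left
  have hsub0 : D0 ⊆ D := h0 ▸ Set.inter_subset_left
  have hsub0p : D0 ⊆ Dp := by
    rw [h0, hp]
    exact Set.inter_subset_inter_right _ fun y hy => (le_of_eq (Eq.symm hy) : _ ≤ _)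
  have hsub0m : D0 ⊆ Dm := by
    rw [h0, hm]
    exact Set.inter_subset_inter_right _ fun y hy => (le_of_eq hy : _ ≤ _)
  have hDL : ∀ {u}, u ∈ D → u ∈ L := by
    intro u hu
    rw [← hD] at hu
    exact hu.1
  obtain ⟨y, hy⟩ := exists_isNearestPoint hconv (hD ▸ isClosed_chamber)
    ⟨x, hD ▸ self_mem_chamber hx.1⟩ z
  have hyL := hDL hy.1
  rcases lt_trichotomy (inner ℝ (n H) y) 0 with hlt | heq | hgt
  · have hyH : y ∉ H := fun h => hlt.ne ((hn H hH y hyL).1 h)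
    have hym : IsNearestPoint Dm z y := hy.mono hsubm (hm ▸ ⟨hy.1, hlt.le⟩)
    obtain ⟨w, hw⟩ := exists_isNearestPoint (hDp ▸ convex_chamber) (hDp ▸ isClosed_chamber)
      ⟨xp, hDp ▸ self_mem_chamber hxp.1⟩ z
    have hw0 : inner ℝ (n H) w = 0 := by
      -- Reversing the normal brings this side into the form of `IsNearestPoint.inner_eq_zero`.
      have h1 : D ∩ {y | 0 ≤ inner ℝ (n H) y} = D ∩ {y | inner ℝ (-n H) y ≤ 0} := by
        simp [inner_neg_left]
      rw [hp, h1] at hw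
      simpa [inner_neg_left] using hy.inner_eq_zero hconv (v := -n H)
        (by rw [inner_neg_left]; linarith) hw
    have hwH : w ∈ H := (hn H hH w (hDL (hsubp hw.1))).2 hw0
    have hwn : IsNearestPoint D0 z w := hw.mono hsub0p (h0 ▸ ⟨hsubp hw.1, hw0⟩)
    rw [iffD hy, iffp hw, iffm hym, iff0 hwn, flatOf_erase_of_notMem hyH,
      flatOf_of_mem hH hHL hwH]
    exact ⟨or_comm, and_comm⟩
  · have hyH : y ∈ H := (hn H hH y hyL).2 heq
    have hyp : IsNearestPoint Dp z y := hy.mono hsubp (hp ▸ ⟨hy.1, heq.ge⟩)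
    have hym : IsNearestPoint Dm z y := hy.mono hsubm (hm ▸ ⟨hy.1, heq.le⟩)
    have hy0 : IsNearestPoint D0 z y := hy.mono hsub0 (h0 ▸ ⟨hy.1, heq⟩)
    -- The only use of genericity of `z`: otherwise `z = y + (z - y)` lies in an excluded subspace.
    have hle : flatOf L (A.erase H) y ≤ H := by
      by_contra hcon
      refine hz _ flatOf_mem_flats hcon (Submodule.mem_sup.2
        ⟨y, ⟨self_mem_flatOf hyL, hyH⟩, z - y, ?_, add_sub_cancel _ _⟩)
      subst hD
      exact hn'.sub_mem_orthogonal_flatOf hx hy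
    rw [iffD hy, iffp hyp, iffm hym, iff0 hy0, flatOf_erase_of_le hle,
      flatOf_of_mem hH hHL hyH]
    exact ⟨Iff.rfl, Iff.rfl⟩
  · have hyH : y ∉ H := fun h => hgt.ne' ((hn H hH y hyL).1 h)
    have hyp : IsNearestPoint Dp z y := hy.mono hsubp (hp ▸ ⟨hy.1, hgt.le⟩)
    obtain ⟨w, hw⟩ := exists_isNearestPoint (hDm ▸ convex_chamber) (hDm ▸ isClosed_chamber)
      ⟨xm, hDm ▸ self_mem_chamber hxm.1⟩ z
    have hw0 : inner ℝ (n H) w = 0 := hy.inner_eq_zero hconv hgt (hm ▸ hw)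
    have hwH : w ∈ H := (hn H hH w (hDL (hsubm hw.1))).2 hw0
    have hwn : IsNearestPoint D0 z w := hw.mono hsub0m (h0 ▸ ⟨hsubm hw.1, hw0⟩)
    rw [iffD hy, iffp hyp, iffm hw, iff0 hwn, flatOf_erase_of_notMem hyH,
      flatOf_of_mem hH hHL hwH]
    exact ⟨Iff.rfl, Iff.rfl⟩

/-- Inclusion-exclusion: the two pairs have almost everywhere the same union and the same
intersection. Intersecting with `B` keeps all measures finite. -/
theorem measureReal_inter_add_eq {Ω : Type*} [MeasurableSpace Ω] {μ : Measure Ω}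
    {s t s' t' B : Set Ω} (ht : MeasurableSet t) (ht' : MeasurableSet t') (hB : MeasurableSet B)
    (hμB : μ B ≠ ⊤)
    (h : ∀ᵐ z ∂μ, ((z ∈ s ∨ z ∈ t) ↔ (z ∈ s' ∨ z ∈ t')) ∧ ((z ∈ s ∧ z ∈ t) ↔ (z ∈ s' ∧ z ∈ t'))) :
    μ.real (s ∩ B) + μ.real (t ∩ B) = μ.real (s' ∩ B) + μ.real (t' ∩ B) := by
  have hfin : ∀ u : Set Ω, μ (u ∩ B) ≠ ⊤ := fun u => measure_inter_ne_top_of_right_ne_top hμB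
  rw [← measureReal_union_add_inter (s := s ∩ B) (ht.inter hB) (hfin _) (hfin _),
    ← measureReal_union_add_inter (s := s' ∩ B) (ht'.inter hB) (hfin _) (hfin _)]
  congr 1
  · refine measureReal_congr ?_
    filter_upwards [h] with z hz
    apply propext
    change (z ∈ s ∧ z ∈ B ∨ z ∈ t ∧ z ∈ B) ↔ (z ∈ s' ∧ z ∈ B ∨ z ∈ t' ∧ z ∈ B)
    tauto
  · refine measureReal_congr ?_
    filter_upwards [h] with z hz
    apply propext
    change ((z ∈ s ∧ z ∈ B) ∧ (z ∈ t ∧ z ∈ B)) ↔ ((z ∈ s' ∧ z ∈ B) ∧ (z ∈ t' ∧ z ∈ B))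
    tauto

/-- The spherical intrinsic volumes are valuations on the pieces of a chamber cut by a
hyperplane. -/
theorem IsNormal.sphVol_cut (hn : IsNormal n L A) (hH : H ∈ A) (hHL : H ≤ L)
    {D : Set (EuclideanSpace ℝ (Fin d))} {xp xm x0 : EuclideanSpace ℝ (Fin d)}
    (hxp : xp ∈ complement L (A.erase H)) (hDp : chamber n L (A.erase H) xp = D)
    (hp : 0 < inner ℝ (n H) xp)
    (hxm : xm ∈ complement L (A.erase H)) (hDm : chamber n L (A.erase H) xm = D)
    (hm : inner ℝ (n H) xm < 0)
    (hx0 : x0 ∈ complement H (A.erase H)) (hD0 : chamber n L (A.erase H) x0 = D) (k : ℕ) :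
    sphVol k (D ∩ {y | 0 ≤ inner ℝ (n H) y}) + sphVol k (D ∩ {y | inner ℝ (n H) y ≤ 0}) =
      sphVol k D + sphVol k (D ∩ {y | inner ℝ (n H) y = 0}) := by
  have hxp' : xp ∈ complement L A := (mem_complement_iff_erase hH).2
    ⟨hxp, fun h => hp.ne' ((hn H hH xp hxp.1).1 h)⟩
  have hxm' : xm ∈ complement L A := (mem_complement_iff_erase hH).2
    ⟨hxm, fun h => hm.ne ((hn H hH xm hxm.1).1 h)⟩
  have ep : chamber n L A xp = D ∩ {y | 0 ≤ inner ℝ (n H) y} := hDp ▸ chamber_of_pos hH hp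
  have em : chamber n L A xm = D ∩ {y | inner ℝ (n H) y ≤ 0} := hDm ▸ chamber_of_neg hH hm
  have e0 : chamber n H (A.erase H) x0 = D ∩ {y | inner ℝ (n H) y = 0} :=
    hD0 ▸ hn.chamber_inter hH hHL
  have hnH : IsNormal n H (A.erase H) := hn.mono hHL (Finset.erase_subset _ _)
  simp only [sphVol, ← add_div]
  congr 1
  refine measureReal_inter_add_eq (em ▸ hn.measurableSet_projSet hxm' k)
    (e0 ▸ hnH.measurableSet_projSet hx0 k) Metric.isClosed_closedBall.measurableSet
    measure_closedBall_lt_top.ne ?_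
  filter_upwards [ae_notMem_sup_orthogonal (flats L (A.erase H)) H] with z hz
  exact hn.mem_projSet_cut hH hHL hxp hDp hxp' ep hxm' em hx0 e0 rfl rfl rfl k hz

end Deletion

/-! ### Summing over the fan -/

section FanSum

variable {d : ℕ} {L H : Submodule ℝ (EuclideanSpace ℝ (Fin d))}
  {A : Finset (Submodule ℝ (EuclideanSpace ℝ (Fin d)))}
  {n : Submodule ℝ (EuclideanSpace ℝ (Fin d)) → EuclideanSpace ℝ (Fin d)}
  {x y z w : EuclideanSpace ℝ (Fin d)}

theorem IsNormal.eventually_mem_complement (hn : IsNormal n L A) (hx : x ∈ complement L A) :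
    ∀ᶠ z in nhds x, z ∈ L → z ∈ complement L A ∧ z ∈ chamber n L A x := by
  have h1 : ∀ᶠ z in nhds x, ∀ H ∈ A, z ∉ H := by
    rw [Filter.eventually_all_finset]
    exact fun H hH => H.closed_of_finiteDimensional.isOpen_compl.mem_nhds (hx.2 H hH)
  filter_upwards [h1, hn.eventually_mem_chamber hx (self_mem_chamber hx.1)] with z hz1 hz2 hzL
  exact ⟨⟨hzL, hz1⟩, hz2 (mem_flatOf.2 ⟨hzL, fun H hH h => absurd h (hx.2 H hH)⟩)⟩

/-- An open half-space that meets the closure of a component meets the component. Consequently a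
chamber that is not cut lies entirely on one closed side. -/
theorem IsNormal.exists_complement_inner_neg (hn : IsNormal n L A) (hx : x ∈ complement L A)
    {v : EuclideanSpace ℝ (Fin d)} (hy : y ∈ chamber n L A x) (hv : inner ℝ v y < 0) :
    ∃ u ∈ complement L A, chamber n L A u = chamber n L A x ∧ inner ℝ v u < 0 := by
  have hy' := hy
  rw [← hn.closure_connectedComponentIn hx, mem_closure_iff] at hy'
  have hopen : IsOpen {z : EuclideanSpace ℝ (Fin d) | inner ℝ v z < 0} :=
    isOpen_lt (by fun_prop) (by fun_prop)
  obtain ⟨u, hu1, hu2⟩ := hy' _ hopen hv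
  have huc := connectedComponentIn_subset _ _ hu2
  refine ⟨u, huc, (hn.chamber_eq_of_mem hx huc ?_).symm, hu1⟩
  rw [← hn.closure_connectedComponentIn hx]
  exact subset_closure hu2

/-- A chamber with points of the complement on both sides of a hyperplane contains such a point
in the hyperplane. -/
theorem IsNormal.exists_complement_inner_eq_zero (hn : IsNormal n L A)
    {v : EuclideanSpace ℝ (Fin d)} (hx : x ∈ complement L A) (hy : y ∈ complement L A)
    (hxy : chamber n L A x = chamber n L A y) (hxv : 0 < inner ℝ v x) (hyv : inner ℝ v y < 0) :
    ∃ u ∈ complement L A, chamber n L A u = chamber n L A x ∧ inner ℝ v u = 0 := by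
  -- Both weights are positive, so `u` keeps the signs of the chamber, and they are chosen to cancel
  -- the values of `v`.
  set u := (-inner ℝ v y) • x + (inner ℝ v x) • y with hu
  have huL : u ∈ L := L.add_mem (L.smul_mem _ hx.1) (L.smul_mem _ hy.1)
  have hyx : y ∈ chamber n L A x := hxy ▸ self_mem_chamber hy.1
  have hpos : ∀ K ∈ A, 0 < inner ℝ (n K) x * inner ℝ (n K) u := by
    intro K hK
    have h1 := mul_self_pos.2 (hn.inner_ne_zero hx hK)
    have h2 := mul_pos (neg_pos.2 hyv) h1
    have h3 := mul_nonneg hxv.le (hyx.2 K hK)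
    rw [hu, inner_add_right, inner_smul_right, inner_smul_right]
    linarith
  have huc : u ∈ complement L A := ⟨huL, fun K hK h => by
    have := hpos K hK
    rw [(hn K hK u huL).1 h, mul_zero] at this
    exact lt_irrefl _ this⟩
  refine ⟨u, huc, (hn.chamber_eq_of_mem hx huc ⟨huL, fun K hK => (hpos K hK).le⟩).symm, ?_⟩
  rw [hu, inner_add_right, inner_smul_right, inner_smul_right]
  ring

theorem finsum_mem_add_eq {α : Type*} {N P Q : Set α} (hN : N.Finite) (hP : P ⊆ N) (hQ : Q ⊆ N)
    (f g p q : α → ℝ)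
    (h : ∀ a ∈ N, (if a ∈ P then p a else 0) + (if a ∈ Q then q a else 0) =
      f a + if a ∈ P ∩ Q then g a else 0) :
    ∑ᶠ a ∈ P, p a + ∑ᶠ a ∈ Q, q a = ∑ᶠ a ∈ N, f a + ∑ᶠ a ∈ P ∩ Q, g a := by
  have key : ∀ (R : Set α) (_ : R ⊆ N) (r : α → ℝ),
      ∑ᶠ a ∈ R, r a = ∑ a ∈ hN.toFinset, if a ∈ R then r a else 0 := by
    intro R hR r
    rw [finsum_mem_eq_finite_toFinset_sum _ (hN.subset hR), ← Finset.sum_filter]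
    refine Finset.sum_congr ?_ fun _ _ => rfl
    ext a
    simp only [Set.Finite.mem_toFinset, Finset.mem_filter]
    exact ⟨fun ha => ⟨hR ha, ha⟩, fun ha => ha.2⟩
  rw [key P hP, key Q hQ, key _ (Set.inter_subset_left.trans hP),
    finsum_mem_eq_finite_toFinset_sum _ hN, ← Finset.sum_add_distrib, ← Finset.sum_add_distrib]
  refine Finset.sum_congr rfl fun a ha => ?_
  convert h a ((Set.Finite.mem_toFinset _).1 ha)

/-- Deletion and restriction for the spherical intrinsic volumes of the fan of an arrangement. -/
theorem fanSphVol_deletion_restriction (hA : IsArrangement L A) (hH : H ∈ A) (k : ℕ) :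
    fanSphVol k (arrFan L A) =
      fanSphVol k (arrFan L (A.erase H)) + fanSphVol k (arrFan H (restriction A H)) := by
  obtain ⟨n, hn⟩ := hA.exists_isNormal
  have hHL := (hA H hH).1
  have hn' : IsNormal n L (A.erase H) := hn.mono le_rfl (Finset.erase_subset _ _)
  have hnH : IsNormal n H (A.erase H) := hn.mono hHL (Finset.erase_subset _ _)
  have hmemH : ∀ x ∈ L, x ∈ H ↔ inner ℝ (n H) x = 0 := hn H hH
  obtain ⟨e, heL, he⟩ : ∃ e ∈ L, 0 < inner ℝ (n H) e := by
    obtain ⟨e, heL, heH⟩ := SetLike.not_le_iff_exists.1 (hA.not_le hH)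
    rcases lt_or_gt_of_ne (fun h => heH ((hmemH e heL).2 h)) with h | h
    · exact ⟨-e, L.neg_mem heL, by rw [inner_neg_right]; linarith⟩
    · exact ⟨e, heL, h⟩
  -- A point of the complement lying on `H` can be pushed to either side along `e` without leaving
  -- its chamber.
  have perturb : ∀ x ∈ complement L (A.erase H), inner ℝ (n H) x = 0 →
      (∃ u ∈ complement L (A.erase H), 0 < inner ℝ (n H) u ∧
        chamber n L (A.erase H) u = chamber n L (A.erase H) x) ∧
      (∃ u ∈ complement L (A.erase H), inner ℝ (n H) u < 0 ∧
        chamber n L (A.erase H) u = chamber n L (A.erase H) x) := by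
    intro x hx hx0
    obtain ⟨s, hs, h1, h2⟩ := eventually_add_smul (hn'.eventually_mem_complement hx) e
    obtain ⟨h3, h4⟩ := h1 (L.add_mem hx.1 (L.smul_mem s heL))
    obtain ⟨h5, h6⟩ := h2 (L.sub_mem hx.1 (L.smul_mem s heL))
    have hse := mul_pos hs he
    refine ⟨⟨_, h3, ?_, (hn'.chamber_eq_of_mem hx h3 h4).symm⟩,
      ⟨_, h5, ?_, (hn'.chamber_eq_of_mem hx h5 h6).symm⟩⟩
    · rw [inner_add_right, inner_smul_right]
      linarith
    · rw [inner_sub_right, inner_smul_right]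
      linarith
  set N := arrFan L (A.erase H) with hNdef
  have hN : N = chamber n L (A.erase H) '' complement L (A.erase H) := hn'.arrFan_eq
  -- `P` and `Q` are the chambers of the deletion reaching the positive and the negative side of
  -- `H`; those in `P ∩ Q` are the ones that are cut.
  set P := chamber n L (A.erase H) '' {x | x ∈ complement L (A.erase H) ∧ 0 < inner ℝ (n H) x}
    with hP
  set Q := chamber n L (A.erase H) '' {x | x ∈ complement L (A.erase H) ∧ inner ℝ (n H) x < 0}
    with hQ
  have hPN : P ⊆ N := hN ▸ Set.image_mono fun _ hx => hx.1
  have hQN : Q ⊆ N := hN ▸ Set.image_mono fun _ hx => hx.1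
  have hNfin : N.Finite := hn'.finite_arrFan
  set ip : Set (EuclideanSpace ℝ (Fin d)) → Set (EuclideanSpace ℝ (Fin d)) :=
    fun D => D ∩ {y | 0 ≤ inner ℝ (n H) y} with hip
  set im : Set (EuclideanSpace ℝ (Fin d)) → Set (EuclideanSpace ℝ (Fin d)) :=
    fun D => D ∩ {y | inner ℝ (n H) y ≤ 0} with him
  set iz : Set (EuclideanSpace ℝ (Fin d)) → Set (EuclideanSpace ℝ (Fin d)) :=
    fun D => D ∩ {y | inner ℝ (n H) y = 0} with hiz
  have hsection : ∀ D ∈ P ∩ Q, ∃ u ∈ complement L (A.erase H),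
      chamber n L (A.erase H) u = D ∧ inner ℝ (n H) u = 0 := by
    rintro D ⟨⟨xp, hxp, rfl⟩, ⟨xm, hxm, hD⟩⟩
    exact hn'.exists_complement_inner_eq_zero hxp.1 hxm.1 hD.symm hxp.2 hxm.2
  have hfanA : arrFan L A = ip '' P ∪ im '' Q := by
    rw [hn.arrFan_eq]
    ext D
    constructor
    · rintro ⟨x, hx, rfl⟩
      obtain ⟨hx', hxH⟩ := (mem_complement_iff_erase hH).1 hx
      rcases lt_or_gt_of_ne (fun h => hxH ((hmemH x hx.1).2 h)) with h | h
      · exact Or.inr ⟨_, ⟨x, ⟨hx', h⟩, rfl⟩, (chamber_of_neg hH h).symm⟩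
      · exact Or.inl ⟨_, ⟨x, ⟨hx', h⟩, rfl⟩, (chamber_of_pos hH h).symm⟩
    · rintro (⟨_, ⟨x, ⟨hx, h⟩, rfl⟩, rfl⟩ | ⟨_, ⟨x, ⟨hx, h⟩, rfl⟩, rfl⟩)
      · exact ⟨x, (mem_complement_iff_erase hH).2 ⟨hx, fun h' => h.ne' ((hmemH x hx.1).1 h')⟩,
          chamber_of_pos hH h⟩
      · exact ⟨x, (mem_complement_iff_erase hH).2 ⟨hx, fun h' => h.ne ((hmemH x hx.1).1 h')⟩,
          chamber_of_neg hH h⟩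
  have hfanH : arrFan H (restriction A H) = iz '' (P ∩ Q) := by
    rw [arrFan_restriction, hnH.arrFan_eq]
    ext D
    constructor
    · rintro ⟨x, hx, rfl⟩
      have hxL : x ∈ complement L (A.erase H) := ⟨hHL hx.1, hx.2⟩
      obtain ⟨⟨u, hu, hu0, hux⟩, ⟨w, hw, hw0, hwx⟩⟩ :=
        perturb x hxL ((hmemH x hxL.1).1 hx.1)
      exact ⟨_, ⟨⟨u, ⟨hu, hu0⟩, hux⟩, ⟨w, ⟨hw, hw0⟩, hwx⟩⟩, (hn.chamber_inter hH hHL).symm⟩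
    · rintro ⟨D, hD, rfl⟩
      obtain ⟨u, hu, rfl, hu0⟩ := hsection D hD
      exact ⟨u, ⟨(hmemH u hu.1).2 hu0, hu.2⟩, hn.chamber_inter hH hHL⟩
  -- Each piece contains a point of the complement of `A.erase H`, which determines the chamber it
  -- came from.
  have hinjp : Set.InjOn ip P := by
    rintro _ ⟨x, ⟨hx, hx0⟩, rfl⟩ _ ⟨y, ⟨hy, hy0⟩, rfl⟩ h
    have hyx : y ∈ ip (chamber n L (A.erase H) x) := h ▸ ⟨self_mem_chamber hy.1, hy0.le⟩
    exact hn'.chamber_eq_of_mem hx hy hyx.1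
  have hinjm : Set.InjOn im Q := by
    rintro _ ⟨x, ⟨hx, hx0⟩, rfl⟩ _ ⟨y, ⟨hy, hy0⟩, rfl⟩ h
    have hyx : y ∈ im (chamber n L (A.erase H) x) := h ▸ ⟨self_mem_chamber hy.1, hy0.le⟩
    exact hn'.chamber_eq_of_mem hx hy hyx.1
  have hinjz : Set.InjOn iz (P ∩ Q) := by
    intro D hD D' hD' h
    obtain ⟨x, hx, rfl, hx0⟩ := hsection D hD
    obtain ⟨y, hy, rfl, hy0⟩ := hsection D' hD'
    have hyx : y ∈ iz (chamber n L (A.erase H) x) := h ▸ ⟨self_mem_chamber hy.1, hy0⟩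
    exact hn'.chamber_eq_of_mem hx hy hyx.1
  have hdisj : Disjoint (ip '' P) (im '' Q) := by
    rw [Set.disjoint_left]
    rintro _ ⟨_, ⟨x, ⟨hx, hx0⟩, rfl⟩, rfl⟩ ⟨D, -, hD⟩
    have hxD : x ∈ im D := hD ▸ ⟨self_mem_chamber hx.1, hx0.le⟩
    exact not_lt.2 hxD.2 hx0
  rw [fanSphVol, fanSphVol, fanSphVol, hfanA, hfanH,
    finsum_mem_union hdisj ((hNfin.subset hPN).image _) ((hNfin.subset hQN).image _),
    finsum_mem_image hinjp, finsum_mem_image hinjm, finsum_mem_image hinjz]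
  refine finsum_mem_add_eq hNfin hPN hQN _ _ _ _ fun D hD => ?_
  have hnotQ : D ∉ Q → ip D = D := by
    intro hDQ
    rw [hN] at hD
    obtain ⟨x, hx, rfl⟩ := hD
    refine Set.inter_eq_left.2 fun y hy => ?_
    by_contra hneg
    obtain ⟨u, hu, hux, hu0⟩ := hn'.exists_complement_inner_neg hx hy (not_le.1 hneg)
    exact hDQ ⟨u, ⟨hu, hu0⟩, hux⟩
  have hnotP : D ∉ P → im D = D := by
    intro hDP
    rw [hN] at hD
    obtain ⟨x, hx, rfl⟩ := hD
    refine Set.inter_eq_left.2 fun y hy => ?_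
    by_contra hneg
    obtain ⟨u, hu, hux, hu0⟩ := hn'.exists_complement_inner_neg (v := -n H) hx hy
      (by rw [inner_neg_left]; exact neg_neg_of_pos (not_le.1 hneg))
    rw [inner_neg_left] at hu0
    exact hDP ⟨u, ⟨hu, by linarith⟩, hux⟩
  have hPQ : D ∈ P ∨ D ∈ Q := by
    rw [hN] at hD
    obtain ⟨x, hx, rfl⟩ := hD
    rcases lt_trichotomy (inner ℝ (n H) x) 0 with h | h | h
    · exact Or.inr ⟨x, ⟨hx, h⟩, rfl⟩
    · obtain ⟨⟨u, hu, hu0, hux⟩, -⟩ := perturb x hx h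
      exact Or.inl ⟨u, ⟨hu, hu0⟩, hux⟩
    · exact Or.inl ⟨x, ⟨hx, h⟩, rfl⟩
  by_cases hDP : D ∈ P <;> by_cases hDQ : D ∈ Q
  · rw [if_pos hDP, if_pos hDQ, if_pos ⟨hDP, hDQ⟩]
    obtain ⟨x0, hx0, hD0, hx00⟩ := hsection D ⟨hDP, hDQ⟩
    obtain ⟨xp, ⟨hxp, hxp0⟩, hDp⟩ := hDP
    obtain ⟨xm, ⟨hxm, hxm0⟩, hDm⟩ := hDQ
    exact hn.sphVol_cut hH hHL hxp hDp hxp0 hxm hDm hxm0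
      ⟨(hmemH x0 hx0.1).2 hx00, hx0.2⟩ hD0 k
  · rw [if_pos hDP, if_neg hDQ, if_neg fun h => hDQ h.2, hnotQ hDQ]
  · rw [if_neg hDP, if_pos hDQ, if_neg fun h => hDP h.1, hnotP hDP]
    ring
  · exact absurd hPQ (by tauto)

/-- The only cone is `L` and every smallest flat is `L`, so the projection set is the whole space or
empty. -/
theorem fanSphVol_empty (k : ℕ) :
    fanSphVol k (arrFan L ∅) = if k = Module.finrank ℝ L then 1 else 0 := by
  have hn : IsNormal 0 L ∅ := fun H hH => absurd hH (Finset.notMem_empty H)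
  have h0 : (0 : EuclideanSpace ℝ (Fin d)) ∈ complement L ∅ := ⟨L.zero_mem, by simp⟩
  have hchamber : ∀ x, chamber 0 L ∅ x = (L : Set (EuclideanSpace ℝ (Fin d))) := fun x => by
    ext y
    simp [chamber]
  have hfan : arrFan L ∅ = {(L : Set (EuclideanSpace ℝ (Fin d)))} := by
    rw [hn.arrFan_eq]
    simp only [hchamber]
    exact Set.Nonempty.image_const ⟨0, h0⟩ _
  have hflat : ∀ y, flatOf L ∅ y = L := fun y => by
    ext w
    simp [mem_flatOf]
  have hproj : ∀ z, z ∈ projSet k (L : Set (EuclideanSpace ℝ (Fin d))) ↔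
      k = Module.finrank ℝ L := by
    intro z
    obtain ⟨y, hy⟩ := exists_isNearestPoint L.convex L.closed_of_finiteDimensional
      ⟨0, L.zero_mem⟩ z
    rw [← hchamber 0] at hy ⊢
    rw [hn.mem_projSet_iff h0 hy, hflat, eq_comm]
  have hne : volume.real (Metric.closedBall (0 : EuclideanSpace ℝ (Fin d)) 1) ≠ 0 :=
    (ENNReal.toReal_pos (Metric.measure_closedBall_pos volume _ one_pos).ne'
      measure_closedBall_lt_top.ne).ne'
  rw [hfan, fanSphVol, finsum_mem_singleton, sphVol]
  split_ifs with hk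
  · rw [Set.eq_univ_of_forall fun z => (hproj z).2 hk, Set.univ_inter, div_self hne]
  · rw [Set.eq_empty_of_forall_notMem fun z hz => hk ((hproj z).1 hz), Set.empty_inter,
      measureReal_empty, zero_div]

theorem fanSphVol_nonneg (k : ℕ) (N : Set (Set (EuclideanSpace ℝ (Fin d)))) :
    0 ≤ fanSphVol k N :=
  finsum_nonneg fun _ => finsum_nonneg fun _ =>
    div_nonneg measureReal_nonneg measureReal_nonneg

theorem fanSphVol_eq_zero {k : ℕ} (hk : d < k) (N : Set (Set (EuclideanSpace ℝ (Fin d)))) :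
    fanSphVol k N = 0 := by
  have hempty : ∀ C : Set (EuclideanSpace ℝ (Fin d)), projSet k C = ∅ := by
    refine fun C => Set.eq_empty_of_forall_notMem fun z => ?_
    rintro ⟨y, F, -, -, -, hF⟩
    have := (Submodule.span ℝ F).finrank_le
    rw [finrank_euclideanSpace_fin] at this
    omega
  simp [fanSphVol, sphVol, hempty]

theorem coeff_fanCharPoly (N : Set (Set (EuclideanSpace ℝ (Fin d)))) (k : ℕ) :
    (fanCharPoly N).coeff k = fanSphVol k N := by
  rw [fanCharPoly, finsetSum_coeff]
  simp only [coeff_C_mul, coeff_X_pow, mul_ite, mul_one, mul_zero]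
  rw [Finset.sum_ite_eq]
  split_ifs with h
  · rfl
  · rw [Finset.mem_range, not_lt] at h
    exact (fanSphVol_eq_zero h N).symm

theorem fanCharPoly_deletion_restriction (hA : IsArrangement L A) (hH : H ∈ A) :
    fanCharPoly (arrFan L A) =
      fanCharPoly (arrFan L (A.erase H)) + fanCharPoly (arrFan H (restriction A H)) := by
  ext k
  simp only [coeff_add, coeff_fanCharPoly, fanSphVol_deletion_restriction hA hH]

theorem fanCharPoly_empty : fanCharPoly (arrFan L ∅) = X ^ Module.finrank ℝ L := by
  ext k
  rw [coeff_fanCharPoly, fanSphVol_empty, coeff_X_pow]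

end FanSum

/-! ### Comparison of the recursions -/

section Main

variable {d : ℕ} {L H : Submodule ℝ (EuclideanSpace ℝ (Fin d))}
  {A : Finset (Submodule ℝ (EuclideanSpace ℝ (Fin d)))}

theorem card_restriction_le (hH : H ∈ A) : (restriction A H).card < A.card :=
  Finset.card_image_le.trans_lt (Finset.card_erase_lt_of_mem hH)

theorem restriction_singleton : restriction {H} H = ∅ := by
  simp [restriction]

/-- Deletion-restriction also holds for a single hyperplane, with both remaining arrangements empty.
Since `dim L = dim H + 1`, the truncated subtraction is exact. -/
theorem fanCharPoly_singleton (hA : IsArrangement L {H}) :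
    fanCharPoly (arrFan L {H}) = X ^ Module.finrank ℝ L + X ^ (Module.finrank ℝ L - 1) := by
  have hH : H ∈ ({H} : Finset (Submodule ℝ (EuclideanSpace ℝ (Fin d)))) :=
    Finset.mem_singleton_self H
  rw [fanCharPoly_deletion_restriction hA hH, Finset.erase_singleton, restriction_singleton,
    fanCharPoly_empty, fanCharPoly_empty, ← (hA H hH).2, Nat.add_sub_cancel]

theorem IsUnsignedCharPoly.eq_fanCharPoly {p : ℝ[X]} (hp : IsUnsignedCharPoly L A p)
    (hA : IsArrangement L A) : p = fanCharPoly (arrFan L A) := by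
  induction hp with
  | empty L => exact fanCharPoly_empty.symm
  | singleton L H => exact (fanCharPoly_singleton hA).symm
  | deletion_restriction L A H p q hH _ _ _ ihp ihq =>
    rw [fanCharPoly_deletion_restriction hA hH, ihp hA.erase, ihq (hA.restriction hH)]

theorem IsArrangement.isUnsignedCharPoly_fanCharPoly (hA : IsArrangement L A) :
    IsUnsignedCharPoly L A (fanCharPoly (arrFan L A)) := by
  induction hc : A.card using Nat.strong_induction_on generalizing L A with
  | _ c ih =>
    subst hc
    rcases A.eq_empty_or_nonempty with rfl | ⟨H, hH⟩
    · rw [fanCharPoly_empty]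
      exact .empty L
    · by_cases h1 : 1 < A.card
      · rw [fanCharPoly_deletion_restriction hA hH]
        exact .deletion_restriction L A H _ _ hH h1
          (ih _ (Finset.card_erase_lt_of_mem hH) hA.erase rfl)
          (ih _ (card_restriction_le hH) (hA.restriction hH) rfl)
      · have hA1 : A = {H} := Finset.eq_singleton_iff_unique_mem.2
          ⟨hH, fun K hK => Finset.card_le_one.1 (not_lt.1 h1) K hK H hH⟩
        subst hA1
        rw [fanCharPoly_singleton hA]
        exact .singleton L H

/-- The minus sign in the recursion of `charPoly` is absorbed by `(-1) ^ dim`, because `H` has one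
dimension less than `L`. -/
theorem IsArrangement.fanCharPoly_eq (hA : IsArrangement L A) :
    fanCharPoly (arrFan L A) = C ((-1 : ℝ) ^ Module.finrank ℝ L) *
      ((charPoly L A).map (Int.castRingHom ℝ)).comp (-X) := by
  induction hc : A.card using Nat.strong_induction_on generalizing L A with
  | _ c ih =>
    subst hc
    rcases A.eq_empty_or_nonempty with rfl | ⟨H, hH⟩
    · rw [fanCharPoly_empty, charPoly_empty, Polynomial.map_pow, map_X, pow_comp, X_comp,
        C_pow, ← mul_pow]
      simp
    · rw [fanCharPoly_deletion_restriction hA hH, charPoly_deletion_restriction hA hH,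
        ih _ (Finset.card_erase_lt_of_mem hH) hA.erase rfl,
        ih _ (card_restriction_le hH) (hA.restriction hH) rfl, Polynomial.map_sub, sub_comp,
        ← (hA H hH).2, pow_succ]
      simp only [mul_neg, mul_one, map_neg]
      ring

theorem IsArrangement.fanSphVol_eq_whitneyNumber (hA : IsArrangement L A) (k : ℕ) :
    fanSphVol k (arrFan L A) = (whitneyNumber L A k : ℝ) := by
  have h1 := congrArg (coeff · k) hA.fanCharPoly_eq
  -- Substituting `-X` only multiplies the `k`-th coefficient by `(-1) ^ k`; all signs then
  -- disappear under the absolute value.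
  have hX : (-X : ℝ[X]) = C (-1) * X := by simp
  simp only [coeff_fanCharPoly, coeff_C_mul] at h1
  rw [hX, comp_C_mul_X_coeff, coeff_map, coeff_charPoly] at h1
  rw [whitneyNumber, ← abs_of_nonneg (fanSphVol_nonneg k _), h1]
  simp [abs_mul]

end Main

end HypArr

theorem corollary2p4 {d : ℕ} (L : Submodule ℝ (EuclideanSpace ℝ (Fin d)))
    (A : Finset (Submodule ℝ (EuclideanSpace ℝ (Fin d)))) (hA : HypArr.IsArrangement L A) :
    (HypArr.arrFan L A).Finite ∧
    (∀ p : ℝ[X], HypArr.IsUnsignedCharPoly L A p ↔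
      p = HypArr.fanCharPoly (HypArr.arrFan L A)) ∧
    HypArr.fanCharPoly (HypArr.arrFan L A) =
      C ((-1 : ℝ) ^ Module.finrank ℝ L) *
        ((HypArr.charPoly L A).map (Int.castRingHom ℝ)).comp (-X) ∧
    (∀ k : ℕ, HypArr.fanSphVol k (HypArr.arrFan L A) = (HypArr.whitneyNumber L A k : ℝ)) := by
  obtain ⟨n, hn⟩ := hA.exists_isNormal
  refine ⟨hn.finite_arrFan, fun p => ⟨fun hp => hp.eq_fanCharPoly hA, ?_⟩, hA.fanCharPoly_eq,
    hA.fanSphVol_eq_whitneyNumber⟩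
  rintro rfl
  exact hA.isUnsignedCharPoly_fanCharPoly
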